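/- Let $\mathcal E$ be the shift operator, $(\mathcal E a)(n)=a(n+1)$, $n\in\mathbb Z$, and let $\mathcal G$ be the associative algebra (with $\mathcal E^j a=(\mathcal E^j a)\mathcal E^j$) spanned by the formal operators $\mathcal E^m+\sum_{j<m}a_j\mathcal E^j$, $m\ge 1$, with rapidly decreasing coefficients $a_j$ on $\mathbb Z$. Let $\hat{\mathcal G}=C^\infty(\mathbb S^1;\mathcal G)$, $\mathbb S^1=\mathbb R/2\pi\mathbb Z\ni y$, with the form $(A,B)=\int_0^{2\pi}\mathrm{Tr}(AB)\,dy$, $\mathrm{Tr}\,A=\sum_n a_0(n)$, and the cocycle $\omega_2(A,B)=(A,\partial B/\partial y)$; let $\hat{\mathcal G}_c=\hat{\mathcal G}\oplus\mathbb C$ be the central extension, $[(A,\alpha),(B,\beta)]=([A,B],\omega_2(A,B))$, identified with its dual $\hat{\mathcal G}_c^*$ by $((A,\alpha),(B,\beta))=(A,B)+\alpha\beta$. Let $W=L^2(\mathbb Z\times\mathbb S^1;\mathbb C)$, let $A_+$, $A_-$, $A_{>0}$ be the parts of $A$ of degree $\ge0$, $<0$, $>0$ in $\mathcal E$, let $\mathcal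 R A=(A_+-A_-)/2$, and let $A^*$ be the transpose of $A$ with respect to the bilinear pairing $\langle f,g\rangle=\sum_n\int fg\,dy$. Write $f\,\mathcal E(\mathcal E-1)^{-1}g=\sum_{k\ge0}f\,\mathcal E^{-k}g$. Let $N\ge 0$. On the phase space of points $(l,c,f_1,\dots,f_N,f_1^*,\dots,f_N^*)\in\hat{\mathcal G}_c^*\oplus W^{2N}$ ($c$ being the central coordinate; for values of Poisson operators the coefficients of $l$ are allowed to be merely integrable on $\mathbb Z\times\mathbb S^1$ instead of smooth and rapidly decreasing, so that $f\mathcal E(\mathcal E-1)^{-1}g$ is admitted for $f,g\in W$) consider, for a functional with gradient $(r,\kappa,\chi,\rho)=(\delta\gamma/\delta l,\delta\gamma/\delta c,\delta\gamma/\delta f,\delta\gamma/\delta f^*)\in\hat{\mathcal G}_c\oplus W^{2N}$, the operator $$\tilde\Theta:(r,\kappa,\chi,\rho)\mapsto\bigl([l-c\partial_y,r_+]-[l-c\partial_y,r]_{>0},\,0,\,-\rho,\,\chi\bigr),$$ the Bäcklund transformation $B(\tilde l,c,f,f^*)=(\tilde l+\sum_i f_i\,\mathcal E(\mathcal E-1)^{-1}f_i^*,c,f,f^*)$,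 and $$\Theta:(r,\kappa,\chi,\rho)\mapsto\Bigl([l-c\partial_y,r_+]-[l-c\partial_y,r]_{>0}+\sum_i\bigl(f_i\,\mathcal E(\mathcal E-1)^{-1}\chi_i-\rho_i\,\mathcal E(\mathcal E-1)^{-1}f_i^*\bigr),\,0,\,-\rho-r_+f,\,\chi+r_+^*f^*\Bigr).$$ Then: (1) $\tilde\Theta$ is the operator of the bracket which is the sum of the $\mathcal R$-deformed Lie–Poisson bracket $(l,[\nabla\gamma,\nabla\mu]_{\mathcal R})+c\,\omega_{2,\mathcal R}(\nabla\gamma,\nabla\mu)$ and the canonical bracket of $(f,f^*)$, where $[A,B]_{\mathcal R}=[\mathcal RA,B]+[A,\mathcal RB]$ and $\omega_{2,\mathcal R}(A,B)=\omega_2(\mathcal RA,B)+\omega_2(A,\mathcal RB)$. (2) $B$ is a bijection, and $\Theta=B'\tilde\Theta B'^*$, where $B'$ is the derivative of $B$, explicitly $B'(h,k,\alpha,\beta)=(h+\sum_i(\alpha_i\mathcal E(\mathcal E-1)^{-1}f_i^*+f_i\mathcal E(\mathcal E-1)^{-1}\beta_i),k,\alpha,\beta)$, and $B'^*$ is its conjugate,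 explicitly $B'^*(r,\kappa,\chi,\rho)=(r,\kappa,\chi+r_+^*f^*,\rho+r_+f)$. (3) $\Theta$ is a Poisson (implectic) operator: it is linear, skew-symmetric, and $\langle a,\Theta'[\Theta b]d\rangle+\langle b,\Theta'[\Theta d]a\rangle+\langle d,\Theta'[\Theta a]b\rangle=0$ for all covectors $a,b,d$. (4) Let $\gamma_n$, $n\in\mathbb N$, be Casimir functionals on $\hat{\mathcal G}_c^*$ (or on a part $U$ of it), i.e. functionals having gradients $\nabla\gamma_n\in\hat{\mathcal G}_c$ and invariant under the infinitesimal coadjoint action of $\hat{\mathcal G}_c$, and write $\nabla\gamma_n(l)\in\hat{\mathcal G}$ for the $l$-component of the gradient. Then at every point $(l,c,f,f^*)\in\hat{\mathcal G}_c^*\oplus W^{2N}$ (with $(l,c)\in U$) the coupled system $$\frac{dl}{dt_n}=[(\nabla\gamma_n(l))_+,\,l-c\,\partial/\partial y],\qquad \frac{df_i}{dt_n}=(\nabla\gamma_n(l))_+f_i,\qquad \frac{df_i^*}{dt_n}=-(\nabla\gamma_n(l))_+^*f_i^*,\qquad i=1,\dots,N,$$ with $dc/dt_n=0$, has its right-hand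 side in $\hat{\mathcal G}_c^*\oplus W^{2N}$ and is the Hamiltonian system $\frac{d}{dt_n}(l,c,f,f^*)=-\Theta\nabla\gamma_n$, where $\gamma_n$ is regarded as a functional on the extended phase space that does not depend on $(f,f^*)$, and its gradient there exists and is unique. -/

import Mathlib

open MeasureTheory
open scoped ContDiff

noncomputable section

namespace ShiftLoop

/-! ## Coefficients: complex functions on `ℤ × S¹`, up to null functions -/

instance factTwoPiPos : Fact (0 < 2 * Real.pi) := ⟨Real.two_pi_pos⟩

/-- The circle `ℝ / 2πℤ`. -/
abbrev S1 := AddCircle (2 * Real.pi)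

/-- Counting measure on `ℤ` times the measure `dy` (of total mass `2π`) on the circle. -/
def mu : Measure (ℤ × S1) := (Measure.count : Measure ℤ).prod (volume : Measure S1)

/-- Almost-everywhere classes of functions `a(n, y)`. -/
abbrev Coef := (ℤ × S1) →ₘ[mu] ℂ

theorem measurePreserving_shift (j : ℤ) :
    MeasurePreserving (fun x : ℤ × S1 => (x.1 + j, x.2)) mu mu := by
  have h : MeasurePreserving (fun n : ℤ => n + j) (Measure.count : Measure ℤ) Measure.count :=
    measurePreserving_add_right Measure.count j
  exact h.prod (MeasurePreserving.id (volume : Measure S1))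

/-- The power `ℰ^j` of the shift operator acting on functions: `(ℰ^j a)(n, y) = a(n + j, y)`. -/
def shift (j : ℤ) (a : Coef) : Coef :=
  a.compMeasurePreserving (fun x : ℤ × S1 => (x.1 + j, x.2)) (measurePreserving_shift j)

/-- The class of an honest function (`0` if the function is not measurable). -/
def cls (g : ℤ × S1 → ℂ) : Coef :=
  open Classical in
  if h : AEStronglyMeasurable g mu then AEEqFun.mk g h else 0

/-- Smoothness in `y`, for every `n`. -/
def IsSmooth (g : ℤ × S1 → ℂ) : Prop :=
  ∀ n : ℤ, ContDiff ℝ ∞ (fun s : ℝ => g (n, (s : S1)))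

/-- Smooth maps from the circle to the rapidly decreasing sequences: all `y`-derivatives decrease
rapidly in `n`, uniformly in `y`. -/
def IsSchwartz (g : ℤ × S1 → ℂ) : Prop :=
  IsSmooth g ∧ ∀ k i : ℕ, ∃ C : ℝ, ∀ (n : ℤ) (y : ℝ),
    |(n : ℝ)| ^ k * ‖iteratedDeriv i (fun s : ℝ => g (n, (s : S1))) y‖ ≤ C

/-- The pointwise derivative `∂g/∂y`. -/
def dyFun (g : ℤ × S1 → ℂ) : ℤ × S1 → ℂ :=
  fun x => deriv (fun s : ℝ => g (x.1, x.2 + (s : S1))) 0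

/-- The derivative `∂a/∂y` of a class that has a representative smooth in `y` (this representative
is unique); the value on other classes is never used. -/
def dy (a : Coef) : Coef :=
  open Classical in
  if h : ∃ g : ℤ × S1 → ℂ, IsSmooth g ∧ a = cls g then cls (dyFun h.choose) else 0

/-! ## Formal shift operators `∑ⱼ aⱼ ℰ^j` -/

/-- A formal operator `∑ⱼ Aⱼ ℰ^j`, given by its coefficients. -/
abbrev Op := ℤ → Coef

/-- The product determined by `ℰ^j a = (ℰ^j a) ℰ^j`. For operators with degree bounded above, each
coefficient is a finite sum. -/
def opMul (A B : Op) : Op := fun k => ∑ᶠ i : ℤ, A i * shift i (B (k - i))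

def opComm (A B : Op) : Op := opMul A B - opMul B A

/-- The part `A₊` of degree `≥ 0`. -/
def posPart (A : Op) : Op := fun j => if 0 ≤ j then A j else 0

/-- The part `A₋` of degree `< 0`. -/
def negPart (A : Op) : Op := fun j => if j < 0 then A j else 0

/-- The part `A_{>0}` of degree `> 0`. -/
def strictPart (A : Op) : Op := fun j => if 0 < j then A j else 0

/-- `∂A/∂y`, coefficientwise. -/
def dyOp (A : Op) : Op := fun j => dy (A j)

/-- `∫₀^{2π} Tr A dy`: the sum over `n` and integral over `y` of the coefficient of `ℰ^0`. -/
def intTr (A : Op) : ℂ := ∫ x, (A 0 : ℤ × S1 → ℂ) x ∂mu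

/-- The bilinear form `(A, B) = ∫₀^{2π} Tr (A B) dy`. -/
def form (A B : Op) : ℂ := intTr (opMul A B)

/-- The Maurer–Cartan cocycle `ω₂(A, B) = (A, ∂B/∂y)`. -/
def omega (A B : Op) : ℂ := form A (dyOp B)

/-- `ℛ = (P₊ - P₋) / 2`. -/
def rMat (A : Op) : Op := (1 / 2 : ℂ) • (posPart A - negPart A)

/-- The `ℛ`-deformed commutator. -/
def rComm (A B : Op) : Op := opComm (rMat A) B + opComm A (rMat B)

/-- The `ℛ`-deformed cocycle. -/
def rOmega (A B : Op) : ℂ := omega (rMat A) B + omega A (rMat B)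

/-- `[l - c ∂/∂y, A] = [l, A] - c ∂A/∂y`. -/
def laxComm (l : Op) (c : ℂ) (A : Op) : Op := opComm l A - c • dyOp A

/-- `(A f)` for an operator with finitely many terms, `(a ℰ^j) f = a · (ℰ^j f)`. -/
def act (A : Op) (f : Coef) : Coef := ∑ᶠ j : ℤ, A j * shift j f

/-- `(A^* f)` for an operator with finitely many terms: the transpose with respect to the bilinear
pairing `⟨f, g⟩ = ∑ₙ ∫ f g dy`, so `(a ℰ^j)^* f = ℰ^{-j} (a · f)`. -/
def actT (A : Op) (f : Coef) : Coef := ∑ᶠ j : ℤ, shift (-j) (A j * f)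

/-- The operator `f ℰ (ℰ - 1)⁻¹ g = ∑_{k ≥ 0} f ℰ^{-k} g`. -/
def dyad (f g : Coef) : Op := fun j => if j ≤ 0 then f * shift j g else 0

/-- The bilinear pairing of eigenfunctions. -/
def pairW (f g : Coef) : ℂ := ∫ x, (f : ℤ × S1 → ℂ) x * (g : ℤ × S1 → ℂ) x ∂mu

/-- Operators with degree bounded above. -/
def BddDegree (A : Op) : Prop := ∃ m : ℤ, ∀ j : ℤ, m < j → A j = 0

/-- The loop algebra `Ĝ` of smooth maps from the circle to the linear span `G` of the operators
`ℰ^m + ∑_{j<m} aⱼ ℰ^j`, `m ≥ 1`, with rapidly decreasing `aⱼ`: every coefficient is rapidly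
decreasing, except that in positive degree a term independent of `n` may be added. -/
def loopAlg : Set Op :=
  {A | BddDegree A ∧ ∀ j : ℤ, ∃ (p : S1 → ℂ) (s : ℤ × S1 → ℂ),
    ContDiff ℝ ∞ (fun y : ℝ => p (y : S1)) ∧ (j ≤ 0 → p = 0) ∧ IsSchwartz s ∧
    A j = cls (fun x => p x.2 + s x)}

/-- The enlargement of `Ĝ` inside its dual in which rapidly decreasing coefficients are replaced by
integrable ones. It contains `f ℰ (ℰ - 1)⁻¹ g` for all `f, g ∈ L²(ℤ × S¹)`. -/
def dualAlg : Set Op :=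
  {A | BddDegree A ∧ ∀ j : ℤ, ∃ (p : S1 → ℂ) (b : Coef),
    ContDiff ℝ ∞ (fun y : ℝ => p (y : S1)) ∧ (j ≤ 0 → p = 0) ∧
    Integrable (b : ℤ × S1 → ℂ) mu ∧ A j = cls (fun x => p x.2) + b}

/-! ## The extended phase space -/

/-- Quadruples `(l, c, f₁, …, f_N, f₁^*, …, f_N^*)`; `c` is the coordinate along the centre. -/
@[ext]
structure Vec (N : ℕ) where
  l : Op
  c : ℂ
  f : Fin N → Coef
  fs : Fin N → Coef

variable {N : ℕ}

instance : Add (Vec N) := ⟨fun x z => ⟨x.l + z.l, x.c + z.c, x.f + z.f, x.fs + z.fs⟩⟩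
instance : Neg (Vec N) := ⟨fun x => ⟨-x.l, -x.c, -x.f, -x.fs⟩⟩
instance : SMul ℂ (Vec N) := ⟨fun t x => ⟨t • x.l, t * x.c, t • x.f, t • x.fs⟩⟩

/-- All the functions `fᵢ`, `fᵢ^*` are square integrable on `ℤ × S¹`. -/
def IsL2 (x : Vec N) : Prop :=
  ∀ i, x.f i ∈ Lp ℂ 2 mu ∧ x.fs i ∈ Lp ℂ 2 mu

/-- The phase space `Ĝ_c^* ⊕ W^{2N}`, where `Ĝ_c^* ≃ Ĝ ⊕ ℂ` through the scalar product, and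
`W = L²(ℤ × S¹)`. Through the pairing below it is also the space of covectors (gradients). -/
def phase (N : ℕ) : Set (Vec N) := {x | x.l ∈ loopAlg ∧ IsL2 x}

/-- The phase space with the operator component in the larger space `dualAlg`. -/
def phaseExt (N : ℕ) : Set (Vec N) := {x | x.l ∈ dualAlg ∧ IsL2 x}

/-- The pairing of a covector with a tangent vector. -/
def pair (a h : Vec N) : ℂ :=
  form a.l h.l + a.c * h.c + ∑ i, (pairW (a.f i) (h.f i) + pairW (a.fs i) (h.fs i))

/-- `a ∈ Ĝ_c ⊕ W^{2N}` is the gradient at `x` of the functional `F` on the phase space: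
`δF(x) = (a, δx)` for all variations `δx`. -/
def HasGradientAt (F : Vec N → ℂ) (x a : Vec N) : Prop :=
  a ∈ phase N ∧ ∀ h ∈ phase N, HasDerivAt (fun t : ℝ => F (x + (t : ℂ) • h)) (pair a h) 0

/-! ## Poisson structures -/

/-- `Θ` is a Poisson (implectic) operator: linear from covectors to tangent vectors, skew-symmetric,
and with `⟨a, Θ'[Θ b] d⟩ + ⟨b, Θ'[Θ d] a⟩ + ⟨d, Θ'[Θ a] b⟩ = 0`, where `Θ'[h]` is the derivative
of `Θ` in the direction `h`; this is the Jacobi identity for `{F, G} = ⟨∇G, Θ ∇F⟩`. -/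
structure IsPoisson (Θ : Vec N → Vec N → Vec N) : Prop where
  maps : ∀ x ∈ phaseExt N, ∀ a ∈ phase N, Θ x a ∈ phaseExt N
  linear : ∀ x ∈ phaseExt N, ∀ a ∈ phase N, ∀ b ∈ phase N, ∀ s : ℂ,
    Θ x (a + s • b) = Θ x a + s • Θ x b
  skew : ∀ x ∈ phaseExt N, ∀ a ∈ phase N, ∀ b ∈ phase N, pair a (Θ x b) = -pair b (Θ x a)
  jacobi : ∀ x ∈ phaseExt N, ∀ a ∈ phase N, ∀ b ∈ phase N, ∀ d ∈ phase N, ∃ u v w : ℂ,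
    HasDerivAt (fun t : ℝ => pair a (Θ (x + (t : ℂ) • Θ x b) d)) u 0 ∧
    HasDerivAt (fun t : ℝ => pair b (Θ (x + (t : ℂ) • Θ x d) a)) v 0 ∧
    HasDerivAt (fun t : ℝ => pair d (Θ (x + (t : ℂ) • Θ x a) b)) w 0 ∧
    u + v + w = 0

/-- The tangent vector `v` at `x` is the value of the Hamiltonian vector field `-Θ ∇F`, and the
gradient `∇F(x)` exists and is unique. -/
def IsHamiltonianAt (Θ : Vec N → Vec N → Vec N) (F : Vec N → ℂ) (x v : Vec N) : Prop :=
  (∃! a, HasGradientAt F x a) ∧ ∀ a, HasGradientAt F x a → v = -Θ x a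

/-- The product of the operators
`r ↦ [l - c∂/∂y, r₊] - [l - c∂/∂y, r]_{>0}` and `(χ, ρ) ↦ (-ρ, χ)`. -/
def thetaTilde (x a : Vec N) : Vec N where
  l := laxComm x.l x.c (posPart a.l) - strictPart (laxComm x.l x.c a.l)
  c := 0
  f := fun i => -a.fs i
  fs := fun i => a.f i

/-- The Bäcklund transformation `l = l̃ + ∑ᵢ fᵢ ℰ (ℰ - 1)⁻¹ fᵢ^*`, `f = f̃`, `f^* = f̃^*`. -/
def backlund (x : Vec N) : Vec N where
  l := x.l + ∑ i, dyad (x.f i) (x.fs i)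
  c := x.c
  f := x.f
  fs := x.fs

/-- The derivative of the Bäcklund transformation at `x`. -/
def backlundDeriv (x h : Vec N) : Vec N where
  l := h.l + ∑ i, (dyad (h.f i) (x.fs i) + dyad (x.f i) (h.fs i))
  c := h.c
  f := h.f
  fs := h.fs

/-- The conjugate of the derivative of the Bäcklund transformation at `x`. -/
def backlundAdj (x a : Vec N) : Vec N where
  l := a.l
  c := a.c
  f := fun i => a.f i + actT (posPart a.l) (x.fs i)
  fs := fun i => a.fs i + act (posPart a.l) (x.f i)

/-- The transformed structure `Θ`. -/
def theta (x a : Vec N) : Vec N where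
  l := laxComm x.l x.c (posPart a.l) - strictPart (laxComm x.l x.c a.l)
    + ∑ i, (dyad (x.f i) (a.f i) - dyad (a.fs i) (x.fs i))
  c := 0
  f := fun i => -a.fs i - act (posPart a.l) (x.f i)
  fs := fun i => a.f i + actT (posPart a.l) (x.fs i)

/-! ## Casimir functionals and the coupled hierarchy -/

/-- `γ`, a functional on `Ĝ_c^*`, has at every point `(l, c)` of `U` a gradient
`grad (l, c) ∈ Ĝ_c`, and is invariant there under the infinitesimal coadjoint action of `Ĝ_c`:
`((l, c), [(A, α), grad (l, c)]) = 0` for all `(A, α)`, where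
`[(A, α), (B, β)] = ([A, B], ω₂(A, B))` and `((A, α), (B, β)) = (A, B) + αβ`. -/
def IsCasimirOn (U : Set (Op × ℂ)) (γ : Op × ℂ → ℂ) (grad : Op × ℂ → Op × ℂ) : Prop :=
  ∀ p ∈ U, (grad p).1 ∈ loopAlg ∧
    (∀ A ∈ loopAlg, ∀ α : ℂ,
      HasDerivAt (fun t : ℝ => γ (p + (t : ℂ) • (A, α)))
        (form (grad p).1 A + (grad p).2 * α) 0) ∧
    ∀ A ∈ loopAlg, form p.1 (opComm A (grad p).1) + p.2 * omega A (grad p).1 = 0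

/-- The right-hand sides of the coupled system
`dl/dt = [r₊, l - c∂/∂y]`, `dc/dt = 0`, `dfᵢ/dt = (r₊ fᵢ)`, `dfᵢ^*/dt = -(r₊^* fᵢ^*)`,
where `r = ∇γ(l)`. -/
def laxField (r : Op) (x : Vec N) : Vec N where
  l := opComm (posPart r) x.l + x.c • dyOp (posPart r)
  c := 0
  f := fun i => act (posPart r) (x.f i)
  fs := fun i => -actT (posPart r) (x.fs i)

end ShiftLoop

end

open ShiftLoop

namespace ShiftLoop

/-! ## The ring of coefficients -/

/-! The operator `theta` is an affine Lie–Poisson structure: `pair_theta` gives ⟨b, Θ(x)a⟩ = ⟨[a,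
b], x⟩ + canon(a, b). Here [a, b] is the bracket of the ℛ-deformed central extension acting on W ⊕ W
through r₊ on f^* and -r₊^* on f, and `canon` is a constant invariant symplectic form. Since Θ is
affine in x, its directional derivatives are pairings with brackets. The Jacobi identity for Θ thus
becomes the Jacobi identity of the bracket together with the cocycle identity of `canon`
(`bracket_jacobi`). It is checked directly, not transported through the Bäcklund transformation.

The deformed bracket is understood through its parts. Mixed terms cancel and [A, B]_ℛ = [A₊, B₊] -
[A₋, B₋] (`rComm_eq`), likewise for the cocycle (`rOmega_eq`), so the identities follow from the
undeformed ones in each part. Those rest on associativity of the product (`opMul_assoc`), cyclicity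
of the trace (`form_comm`, from shift invariance of the measure), and integration by parts in y
(`omega_skew`, `omega_cocycle`).

The factorization Θ = B'Θ̃B'^* rests on `lieField_dyad`: on D = fℰ(ℰ-1)⁻¹g with c = 0, the field [D,
r₊] - [D, r]_{>0} is again a difference of two such operators, with r₊^* applied to g and r₊ applied
to f. The adjoint B'^* comes from `form_dyad`, that is (r, D) = ⟨r₊f, g⟩.

For a Casimir functional, nondegeneracy of the form turns coadjoint invariance into [l - c∂, r] = 0
(`laxComm_eq_zero`). Then only the r₊ terms of Θ survive, and they are the coupled system up to
sign. Nondegeneracy of all the pairings also makes the gradient unique (`eq_of_pair_eq`).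

Covectors have smooth coefficients while points of the extended phase space may have merely
integrable ones. Every product below therefore has at most one factor outside the loop algebra. -/

noncomputable instance : CommRing Coef :=
  { (inferInstance : AddCommGroup Coef), (inferInstance : CommMonoid Coef) with
    left_distrib := fun a b c => AEEqFun.induction_on₃ a b c fun f hf g hg h hh => by
      simp only [AEEqFun.mk_add_mk, AEEqFun.mk_mul_mk, mul_add]
    right_distrib := fun a b c => AEEqFun.induction_on₃ a b c fun f hf g hg h hh => by
      simp only [AEEqFun.mk_add_mk, AEEqFun.mk_mul_mk, add_mul]
    zero_mul := fun a => AEEqFun.induction_on a fun f hf => by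
      simp only [AEEqFun.zero_def, AEEqFun.mk_mul_mk, zero_mul, Pi.mul_def]
    mul_zero := fun a => AEEqFun.induction_on a fun f hf => by
      simp only [AEEqFun.zero_def, AEEqFun.mk_mul_mk, mul_zero, Pi.mul_def] }

instance : IsScalarTower ℂ Coef Coef :=
  ⟨fun t a b => AEEqFun.induction_on₂ a b fun f hf g hg => by
    simp only [smul_eq_mul, AEEqFun.smul_mk, AEEqFun.mk_mul_mk, smul_mul_assoc]⟩

instance : SMulCommClass ℂ Coef Coef :=
  ⟨fun t a b => AEEqFun.induction_on₂ a b fun f hf g hg => by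
    simp only [smul_eq_mul, AEEqFun.smul_mk, AEEqFun.mk_mul_mk, mul_smul_comm]⟩

theorem shift_mk (j : ℤ) (f : ℤ × S1 → ℂ) (hf : AEStronglyMeasurable f mu) :
    shift j (AEEqFun.mk f hf) = AEEqFun.mk (fun x => f (x.1 + j, x.2))
      (hf.comp_measurePreserving (measurePreserving_shift j)) := rfl

/-- The shift as a ring endomorphism of the coefficients. -/
noncomputable def shiftHom (j : ℤ) : Coef →+* Coef where
  toFun := shift j
  map_one' := rfl
  map_zero' := rfl
  map_mul' a b := AEEqFun.induction_on₂ a b fun f hf g hg => by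
    simp only [AEEqFun.mk_mul_mk, shift_mk]; rfl
  map_add' a b := AEEqFun.induction_on₂ a b fun f hf g hg => by
    simp only [AEEqFun.mk_add_mk, shift_mk]; rfl

@[simp] theorem shift_zero (j : ℤ) : shift j 0 = 0 := map_zero (shiftHom j)

theorem shift_add (j : ℤ) (a b : Coef) : shift j (a + b) = shift j a + shift j b :=
  map_add (shiftHom j) a b

theorem shift_mul (j : ℤ) (a b : Coef) : shift j (a * b) = shift j a * shift j b :=
  map_mul (shiftHom j) a b

theorem shift_smul (j : ℤ) (t : ℂ) (a : Coef) : shift j (t • a) = t • shift j a :=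
  AEEqFun.induction_on a fun f hf => by simp only [AEEqFun.smul_mk, shift_mk]; rfl

theorem shift_shift (i j : ℤ) (a : Coef) : shift i (shift j a) = shift (i + j) a :=
  AEEqFun.induction_on a fun f hf => by simp only [shift_mk, add_assoc]

@[simp] theorem shift_by_zero (a : Coef) : shift 0 a = a :=
  AEEqFun.induction_on a fun f hf => by simp only [shift_mk, add_zero]

/-! ## Integrals of coefficients -/

/-- The sum over `n` and integral over `y` of a coefficient. -/
noncomputable def integ (a : Coef) : ℂ := ∫ x, (a : ℤ × S1 → ℂ) x ∂mu

theorem mem_L1_iff {a : Coef} : a ∈ Lp ℂ 1 mu ↔ Integrable (a : ℤ × S1 → ℂ) mu := by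
  rw [Lp.mem_Lp_iff_memLp, memLp_one_iff_integrable]

theorem integ_mk (f : ℤ × S1 → ℂ) (hf : AEStronglyMeasurable f mu) :
    integ (AEEqFun.mk f hf) = ∫ x, f x ∂mu :=
  integral_congr_ae (AEEqFun.coeFn_mk f hf)

@[simp] theorem integ_zero : integ 0 = 0 := by
  rw [AEEqFun.zero_def, integ_mk]; simp

theorem integ_add {a b : Coef} (ha : a ∈ Lp ℂ 1 mu) (hb : b ∈ Lp ℂ 1 mu) :
    integ (a + b) = integ a + integ b := by
  rw [integ, integral_congr_ae (AEEqFun.coeFn_add a b)]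
  exact integral_add (mem_L1_iff.1 ha) (mem_L1_iff.1 hb)

theorem integ_smul (t : ℂ) (a : Coef) : integ (t • a) = t * integ a := by
  rw [integ, integral_congr_ae (AEEqFun.coeFn_smul t a)]
  exact integral_const_mul _ _

theorem integ_sum {ι : Type*} (s : Finset ι) (a : ι → Coef) (ha : ∀ i ∈ s, a i ∈ Lp ℂ 1 mu) :
    integ (∑ i ∈ s, a i) = ∑ i ∈ s, integ (a i) := by
  classical
  induction s using Finset.induction_on with
  | empty => simp
  | insert i s hi ih =>
    rw [Finset.sum_insert hi, Finset.sum_insert hi, integ_add (ha i (by simp))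
      (sum_mem fun k hk => ha k (by simp [hk])), ih fun k hk => ha k (by simp [hk])]

/-- This invariance is the source both of the cyclicity of the trace and of the duality between
`act` and `actT`. -/
theorem integ_shift (j : ℤ) (a : Coef) : integ (shift j a) = integ a :=
  AEEqFun.induction_on a fun f hf => by
    have hf' : AEStronglyMeasurable f (Measure.map (fun x : ℤ × S1 => (x.1 + j, x.2)) mu) := by
      rwa [(measurePreserving_shift j).map_eq]
    rw [shift_mk, integ_mk, integ_mk,
      ← integral_map (measurePreserving_shift j).measurable.aemeasurable hf',
      (measurePreserving_shift j).map_eq]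

theorem shift_mem_Lp {p : ENNReal} (j : ℤ) {a : Coef} (ha : a ∈ Lp ℂ p mu) :
    shift j a ∈ Lp ℂ p mu :=
  AEEqFun.compMeasurePreserving_mem_Lp ha (measurePreserving_shift j)

theorem mul_mem_Lp {p q r : ENNReal} [p.HolderTriple q r] {a b : Coef} (ha : a ∈ Lp ℂ p mu)
    (hb : b ∈ Lp ℂ q mu) : a * b ∈ Lp ℂ r mu := by
  rw [Lp.mem_Lp_iff_memLp] at *
  exact (hb.mul ha).ae_eq (AEEqFun.coeFn_mul a b).symm

theorem pairW_eq_integ (f g : Coef) : pairW f g = integ (f * g) :=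
  integral_congr_ae (AEEqFun.coeFn_mul f g).symm

/-! ## Smooth representatives -/

/-- With positive measure on nonempty open sets, a class has at most one continuous representative;
this makes the choice inside `dy` harmless. -/
instance : (Measure.count : Measure ℤ).IsOpenPosMeasure :=
  ⟨fun _ _ hne h => hne.ne_empty (Measure.count_eq_zero_iff.1 h)⟩

instance : mu.IsOpenPosMeasure := by unfold mu; infer_instance

theorem IsSmooth.continuous {g : ℤ × S1 → ℂ} (hg : IsSmooth g) : Continuous g := by
  rw [continuous_prod_of_discrete_left]
  intro n
  have hq : Topology.IsQuotientMap (fun s : ℝ => (s : S1)) := QuotientAddGroup.isQuotientMap_mk _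
  exact hq.continuous_iff.2 (hg n).continuous

theorem cls_eq_mk {g : ℤ × S1 → ℂ} (hg : AEStronglyMeasurable g mu) :
    cls g = AEEqFun.mk g hg := by
  unfold cls; rw [dif_pos hg]

theorem IsSmooth.aesm {g : ℤ × S1 → ℂ} (hg : IsSmooth g) : AEStronglyMeasurable g mu :=
  hg.continuous.aestronglyMeasurable

theorem IsSmooth.add {g h : ℤ × S1 → ℂ} (hg : IsSmooth g) (hh : IsSmooth h) :
    IsSmooth (g + h) := fun n => (hg n).add (hh n)

theorem IsSmooth.mul {g h : ℤ × S1 → ℂ} (hg : IsSmooth g) (hh : IsSmooth h) :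
    IsSmooth (g * h) := fun n => (hg n).mul (hh n)

theorem IsSmooth.smul {g : ℤ × S1 → ℂ} (t : ℂ) (hg : IsSmooth g) :
    IsSmooth (t • g) := fun n => contDiff_const.smul (hg n)

theorem isSmooth_zero : IsSmooth 0 := fun _ => contDiff_const

theorem IsSmooth.shift {g : ℤ × S1 → ℂ} (j : ℤ) (hg : IsSmooth g) :
    IsSmooth (fun x => g (x.1 + j, x.2)) := fun n => hg (n + j)

theorem cls_add {g h : ℤ × S1 → ℂ} (hg : IsSmooth g) (hh : IsSmooth h) :
    cls (g + h) = cls g + cls h := by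
  rw [cls_eq_mk hg.aesm, cls_eq_mk hh.aesm, cls_eq_mk (hg.add hh).aesm, AEEqFun.mk_add_mk]

theorem cls_mul {g h : ℤ × S1 → ℂ} (hg : IsSmooth g) (hh : IsSmooth h) :
    cls (g * h) = cls g * cls h := by
  rw [cls_eq_mk hg.aesm, cls_eq_mk hh.aesm, cls_eq_mk (hg.mul hh).aesm, AEEqFun.mk_mul_mk]

theorem cls_smul {g : ℤ × S1 → ℂ} (t : ℂ) (hg : IsSmooth g) :
    cls (t • g) = t • cls g := by
  rw [cls_eq_mk hg.aesm, cls_eq_mk (hg.smul t).aesm, AEEqFun.smul_mk]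

theorem cls_zero : cls 0 = 0 := cls_eq_mk isSmooth_zero.aesm

theorem shift_cls {g : ℤ × S1 → ℂ} (j : ℤ) (hg : IsSmooth g) :
    shift j (cls g) = cls (fun x => g (x.1 + j, x.2)) := by
  rw [cls_eq_mk hg.aesm, cls_eq_mk (hg.shift j).aesm, shift_mk]

theorem cls_injective {g h : ℤ × S1 → ℂ} (hg : IsSmooth g) (hh : IsSmooth h)
    (e : cls g = cls h) : g = h := by
  rw [cls_eq_mk hg.aesm, cls_eq_mk hh.aesm, AEEqFun.mk_eq_mk] at e
  exact (Continuous.ae_eq_iff_eq mu hg.continuous hh.continuous).1 e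

/-! ## The derivative along the circle -/

theorem dyFun_slice (g : ℤ × S1 → ℂ) (n : ℤ) :
    (fun s : ℝ => dyFun g (n, (s : S1))) = deriv (fun s : ℝ => g (n, (s : S1))) := by
  funext s
  have := deriv_comp_const_add (fun s : ℝ => g (n, (s : S1))) s 0
  simpa [dyFun, AddCircle.coe_add] using this

theorem iteratedDeriv_slice (i : ℕ) (g : ℤ × S1 → ℂ) (n : ℤ) :
    iteratedDeriv i (fun s : ℝ => g (n, (s : S1))) =
      fun s : ℝ => (dyFun^[i] g) (n, (s : S1)) := by
  induction i generalizing g with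
  | zero => simp
  | succ i ih => rw [iteratedDeriv_succ', ← dyFun_slice, ih, Function.iterate_succ_apply]

theorem IsSmooth.dyFun {g : ℤ × S1 → ℂ} (hg : IsSmooth g) : IsSmooth (dyFun g) := by
  intro n
  rw [dyFun_slice]
  exact (contDiff_infty_iff_deriv.1 (hg n)).2

theorem IsSmooth.differentiable {g : ℤ × S1 → ℂ} (hg : IsSmooth g) (n : ℤ) :
    Differentiable ℝ (fun s : ℝ => g (n, (s : S1))) := (hg n).differentiable (by simp)

theorem ext_slice {g h : ℤ × S1 → ℂ}
    (e : ∀ (n : ℤ) (s : ℝ), g (n, (s : S1)) = h (n, (s : S1))) : g = h := by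
  funext x
  obtain ⟨n, y⟩ := x
  obtain ⟨s, rfl⟩ := QuotientAddGroup.mk_surjective y
  exact e n s

theorem dyFun_add {g h : ℤ × S1 → ℂ} (hg : IsSmooth g) (hh : IsSmooth h) :
    dyFun (g + h) = dyFun g + dyFun h := by
  refine ext_slice fun n s => ?_
  have e (g) := congrFun (dyFun_slice g n) s
  simp only [Pi.add_apply] at e ⊢
  rw [e, e, e]
  exact deriv_add (hg.differentiable n s) (hh.differentiable n s)

theorem dyFun_mul {g h : ℤ × S1 → ℂ} (hg : IsSmooth g) (hh : IsSmooth h) :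
    dyFun (g * h) = dyFun g * h + g * dyFun h := by
  refine ext_slice fun n s => ?_
  have e (g) := congrFun (dyFun_slice g n) s
  simp only [Pi.add_apply, Pi.mul_apply] at e ⊢
  rw [e, e, e]
  exact deriv_mul (hg.differentiable n s) (hh.differentiable n s)

theorem dyFun_smul {g : ℤ × S1 → ℂ} (t : ℂ) (hg : IsSmooth g) :
    dyFun (t • g) = t • dyFun g := by
  refine ext_slice fun n s => ?_
  have e (g) := congrFun (dyFun_slice g n) s
  simp only [Pi.smul_apply] at e ⊢
  rw [e, e]
  exact deriv_const_smul t (hg.differentiable n s)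

theorem dyFun_shift (j : ℤ) (g : ℤ × S1 → ℂ) :
    dyFun (fun x => g (x.1 + j, x.2)) = fun x => dyFun g (x.1 + j, x.2) := rfl

theorem dy_cls {g : ℤ × S1 → ℂ} (hg : IsSmooth g) : dy (cls g) = cls (dyFun g) := by
  have h : ∃ g' : ℤ × S1 → ℂ, IsSmooth g' ∧ cls g = cls g' := ⟨g, hg, rfl⟩
  unfold dy
  rw [dif_pos h, ← cls_injective hg h.choose_spec.1 h.choose_spec.2]

/-- The classes of functions smooth in `y`. -/
def smoothCoef : Submodule ℂ Coef where
  carrier := {a | ∃ g, IsSmooth g ∧ a = cls g}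
  zero_mem' := ⟨0, isSmooth_zero, cls_zero.symm⟩
  add_mem' := by
    rintro _ _ ⟨g, hg, rfl⟩ ⟨h, hh, rfl⟩
    exact ⟨_, hg.add hh, (cls_add hg hh).symm⟩
  smul_mem' := by
    rintro t _ ⟨g, hg, rfl⟩
    exact ⟨_, hg.smul t, (cls_smul t hg).symm⟩

theorem mul_mem_smoothCoef {a b : Coef} (ha : a ∈ smoothCoef) (hb : b ∈ smoothCoef) :
    a * b ∈ smoothCoef := by
  obtain ⟨g, hg, rfl⟩ := ha
  obtain ⟨h, hh, rfl⟩ := hb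
  exact ⟨_, hg.mul hh, (cls_mul hg hh).symm⟩

theorem shift_mem_smoothCoef (j : ℤ) {a : Coef} (ha : a ∈ smoothCoef) :
    shift j a ∈ smoothCoef := by
  obtain ⟨g, hg, rfl⟩ := ha
  exact ⟨_, hg.shift j, shift_cls j hg⟩

theorem dy_add {a b : Coef} (ha : a ∈ smoothCoef) (hb : b ∈ smoothCoef) :
    dy (a + b) = dy a + dy b := by
  obtain ⟨g, hg, rfl⟩ := ha
  obtain ⟨h, hh, rfl⟩ := hb
  rw [← cls_add hg hh, dy_cls hg, dy_cls hh, dy_cls (hg.add hh), dyFun_add hg hh,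
    cls_add hg.dyFun hh.dyFun]

theorem dy_mul {a b : Coef} (ha : a ∈ smoothCoef) (hb : b ∈ smoothCoef) :
    dy (a * b) = dy a * b + a * dy b := by
  obtain ⟨g, hg, rfl⟩ := ha
  obtain ⟨h, hh, rfl⟩ := hb
  rw [← cls_mul hg hh, dy_cls hg, dy_cls hh, dy_cls (hg.mul hh), dyFun_mul hg hh,
    cls_add (hg.dyFun.mul hh) (hg.mul hh.dyFun), cls_mul hg.dyFun hh, cls_mul hg hh.dyFun]

theorem dy_smul {a : Coef} (t : ℂ) (ha : a ∈ smoothCoef) : dy (t • a) = t • dy a := by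
  obtain ⟨g, hg, rfl⟩ := ha
  rw [← cls_smul t hg, dy_cls hg, dy_cls (hg.smul t), dyFun_smul t hg, cls_smul t hg.dyFun]

theorem dy_shift {a : Coef} (j : ℤ) (ha : a ∈ smoothCoef) : dy (shift j a) = shift j (dy a) := by
  obtain ⟨g, hg, rfl⟩ := ha
  rw [shift_cls j hg, dy_cls hg, dy_cls (hg.shift j), dyFun_shift, shift_cls j hg.dyFun]

@[simp] theorem dy_zero : dy 0 = 0 := by
  simpa using dy_smul 0 (zero_mem smoothCoef)

theorem dy_sum {ι : Type*} (s : Finset ι) (a : ι → Coef) (ha : ∀ i ∈ s, a i ∈ smoothCoef) :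
    dy (∑ i ∈ s, a i) = ∑ i ∈ s, dy (a i) := by
  classical
  induction s using Finset.induction_on with
  | empty => simp
  | insert i s hi ih =>
    rw [Finset.sum_insert hi, Finset.sum_insert hi, dy_add (ha i (by simp))
      (sum_mem fun k hk => ha k (by simp [hk])), ih fun k hk => ha k (by simp [hk])]

/-! ## Decay in the discrete variable -/

/-- Smooth in `y`, with all `y`-derivatives bounded after multiplication by `|n| ^ k`. -/
def Decays (k : ℕ) (g : ℤ × S1 → ℂ) : Prop :=
  IsSmooth g ∧ ∀ i : ℕ, ∃ C : ℝ, ∀ x : ℤ × S1, |(x.1 : ℝ)| ^ k * ‖(dyFun^[i] g) x‖ ≤ C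

/-- Fixing one exponent k at a time makes exponents add under products, and exponent 0 also covers
functions of y alone, which are bounded but do not decay. -/
theorem isSchwartz_iff {g : ℤ × S1 → ℂ} : IsSchwartz g ↔ ∀ k, Decays k g := by
  have h (k i : ℕ) (C : ℝ) : (∀ (n : ℤ) (y : ℝ),
      |(n : ℝ)| ^ k * ‖iteratedDeriv i (fun s : ℝ => g (n, (s : S1))) y‖ ≤ C) ↔
      ∀ x : ℤ × S1, |(x.1 : ℝ)| ^ k * ‖(dyFun^[i] g) x‖ ≤ C := by
    simp only [iteratedDeriv_slice, Prod.forall]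
    refine forall_congr' fun n => ⟨fun H y => ?_, fun H y => H y⟩
    obtain ⟨s, rfl⟩ := QuotientAddGroup.mk_surjective y
    exact H s
  simp only [IsSchwartz, Decays, h]
  exact ⟨fun H k => ⟨H.1, H.2 k⟩, fun H => ⟨(H 0).1, fun k => (H k).2⟩⟩

theorem Decays.dyFun {k : ℕ} {g : ℤ × S1 → ℂ} (hg : Decays k g) : Decays k (dyFun g) :=
  ⟨hg.1.dyFun, fun i => by simpa only [Function.iterate_succ_apply] using hg.2 (i + 1)⟩

theorem iterate_dyFun_add (i : ℕ) {g h : ℤ × S1 → ℂ} (hg : IsSmooth g) (hh : IsSmooth h) :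
    dyFun^[i] (g + h) = dyFun^[i] g + dyFun^[i] h := by
  induction i generalizing g h with
  | zero => rfl
  | succ i ih => simp only [Function.iterate_succ_apply, dyFun_add hg hh, ih hg.dyFun hh.dyFun]

theorem iterate_dyFun_smul (i : ℕ) (t : ℂ) {g : ℤ × S1 → ℂ} (hg : IsSmooth g) :
    dyFun^[i] (t • g) = t • dyFun^[i] g := by
  induction i generalizing g with
  | zero => rfl
  | succ i ih => simp only [Function.iterate_succ_apply, dyFun_smul t hg, ih hg.dyFun]

theorem Decays.add {k : ℕ} {g h : ℤ × S1 → ℂ} (hg : Decays k g) (hh : Decays k h) :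
    Decays k (g + h) := by
  refine ⟨hg.1.add hh.1, fun i => ?_⟩
  obtain ⟨C, hC⟩ := hg.2 i
  obtain ⟨D, hD⟩ := hh.2 i
  refine ⟨C + D, fun x => ?_⟩
  rw [iterate_dyFun_add i hg.1 hh.1]
  calc _ ≤ |(x.1 : ℝ)| ^ k * (‖(ShiftLoop.dyFun^[i] g) x‖ + ‖(ShiftLoop.dyFun^[i] h) x‖) := by
        gcongr; exact norm_add_le _ _
    _ ≤ C + D := by rw [mul_add]; exact add_le_add (hC x) (hD x)

theorem Decays.smul {k : ℕ} {g : ℤ × S1 → ℂ} (t : ℂ) (hg : Decays k g) : Decays k (t • g) := by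
  refine ⟨hg.1.smul t, fun i => ?_⟩
  obtain ⟨C, hC⟩ := hg.2 i
  refine ⟨‖t‖ * C, fun x => ?_⟩
  rw [iterate_dyFun_smul i t hg.1, Pi.smul_apply, norm_smul, mul_left_comm]
  exact mul_le_mul_of_nonneg_left (hC x) (norm_nonneg _)

theorem Decays.mul {k m : ℕ} {g h : ℤ × S1 → ℂ} (hg : Decays k g) (hh : Decays m h) :
    Decays (k + m) (g * h) := by
  refine ⟨hg.1.mul hh.1, fun i => ?_⟩
  -- One application of the Leibniz rule reduces order i + 1 for gh to order i for ∂g·h and g·∂h,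
  -- whose factors decay at the same rates; no binomial expansion is needed.
  induction i generalizing g h with
  | zero =>
    obtain ⟨C, hC⟩ := hg.2 0
    obtain ⟨D, hD⟩ := hh.2 0
    refine ⟨C * D, fun x => ?_⟩
    have hC0 : 0 ≤ C := le_trans (by positivity) (hC x)
    calc _ = (|(x.1 : ℝ)| ^ k * ‖g x‖) * (|(x.1 : ℝ)| ^ m * ‖h x‖) := by
          simp only [Function.iterate_zero, id, Pi.mul_apply, norm_mul]; ring
      _ ≤ C * D := mul_le_mul (hC x) (hD x) (by positivity) hC0
  | succ i ih =>
    obtain ⟨C, hC⟩ := ih hg.dyFun hh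
    obtain ⟨D, hD⟩ := ih hg hh.dyFun
    refine ⟨C + D, fun x => ?_⟩
    rw [Function.iterate_succ_apply, dyFun_mul hg.1 hh.1,
      iterate_dyFun_add i (hg.1.dyFun.mul hh.1) (hg.1.mul hh.1.dyFun)]
    calc _ ≤ |(x.1 : ℝ)| ^ (k + m) * (‖(ShiftLoop.dyFun^[i] (ShiftLoop.dyFun g * h)) x‖
            + ‖(ShiftLoop.dyFun^[i] (g * ShiftLoop.dyFun h)) x‖) := by
          gcongr; exact norm_add_le _ _
      _ ≤ C + D := by rw [mul_add]; exact add_le_add (hC x) (hD x)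

theorem iterate_dyFun_shift (i : ℕ) (j : ℤ) (g : ℤ × S1 → ℂ) :
    dyFun^[i] (fun x => g (x.1 + j, x.2)) = fun x => (dyFun^[i] g) (x.1 + j, x.2) := by
  induction i generalizing g with
  | zero => rfl
  | succ i ih => simp only [Function.iterate_succ_apply, dyFun_shift, ih]

theorem IsSchwartz.shift {g : ℤ × S1 → ℂ} (j : ℤ) (hg : IsSchwartz g) :
    IsSchwartz (fun x => g (x.1 + j, x.2)) := by
  rw [isSchwartz_iff] at *
  refine fun k => ⟨(hg k).1.shift j, fun i => ?_⟩
  obtain ⟨C, hC⟩ := (hg k).2 i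
  obtain ⟨D, hD⟩ := (hg 0).2 i
  -- From |n| ≤ |n + j| + |j| one gets |n|^k ≤ 2^(k-1)(|n + j|^k + |j|^k); the first term uses decay
  -- of exponent k, the second only boundedness.
  refine ⟨2 ^ (k - 1) * (C + |(j : ℝ)| ^ k * D), fun x => ?_⟩
  rw [iterate_dyFun_shift]
  have h1 : |(x.1 : ℝ)| ≤ |((x.1 + j : ℤ) : ℝ)| + |(j : ℝ)| := by
    have := abs_sub ((x.1 + j : ℤ) : ℝ) (j : ℝ)
    push_cast at this ⊢
    simpa using this
  have hC' := hC (x.1 + j, x.2)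
  have hD' := hD (x.1 + j, x.2)
  simp only [pow_zero, one_mul] at hC' hD'
  calc |(x.1 : ℝ)| ^ k * ‖(dyFun^[i] g) (x.1 + j, x.2)‖
      ≤ (2 ^ (k - 1) * (|((x.1 + j : ℤ) : ℝ)| ^ k + |(j : ℝ)| ^ k)) *
        ‖(dyFun^[i] g) (x.1 + j, x.2)‖ := by
        gcongr
        exact (pow_le_pow_left₀ (abs_nonneg _) h1 k).trans
          (add_pow_le (abs_nonneg _) (abs_nonneg _) k)
    _ = 2 ^ (k - 1) * (|((x.1 + j : ℤ) : ℝ)| ^ k * ‖(dyFun^[i] g) (x.1 + j, x.2)‖ +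
        |(j : ℝ)| ^ k * ‖(dyFun^[i] g) (x.1 + j, x.2)‖) := by ring
    _ ≤ _ := by gcongr

theorem decays_comp_snd {p : S1 → ℂ} (hp : ContDiff ℝ ∞ (fun y : ℝ => p (y : S1))) :
    Decays 0 (fun x => p x.2) := by
  have hs : IsSmooth (fun x => p x.2) := fun _ => hp
  refine ⟨hs, fun i => ?_⟩
  have hi : IsSmooth (dyFun^[i] (fun x => p x.2)) := by
    clear hp
    generalize (fun x : ℤ × S1 => p x.2) = g at hs
    induction i generalizing g with
    | zero => exact hs
    | succ i ih => exact ih _ hs.dyFun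
  obtain ⟨C, hC⟩ := isCompact_univ.exists_bound_of_continuousOn (s := (Set.univ : Set S1))
    (f := fun y => (dyFun^[i] (fun x : ℤ × S1 => p x.2)) (0, y))
    (hi.continuous.comp (by fun_prop)).continuousOn
  refine ⟨C, fun x => ?_⟩
  -- The derivatives inherit independence of n, so the compactness bound on the row n = 0 serves
  -- every row.
  have h0 := congrFun (iterate_dyFun_shift i x.1 (fun x => p x.2)) (0, x.2)
  simp only [zero_add] at h0
  rw [pow_zero, one_mul, show x = (x.1, x.2) from rfl, ← h0]
  exact hC x.2 trivial

/-- Cutting off to a single row commutes with ∂/∂y and yields the test functions used for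
nondegeneracy of the form. -/
theorem IsSmooth.isSchwartz_single {g : ℤ × S1 → ℂ} (hg : IsSmooth g) (m : ℤ) :
    IsSchwartz (fun x => if x.1 = m then g x else 0) := by
  have hs {g : ℤ × S1 → ℂ} (hg : IsSmooth g) :
      IsSmooth (fun x => if x.1 = m then g x else 0) := by
    intro n
    by_cases h : n = m
    · simpa only [h, if_true] using hg m
    · simpa only [h, if_false] using contDiff_const
  have hd (g : ℤ × S1 → ℂ) : ShiftLoop.dyFun (fun x => if x.1 = m then g x else 0) =
      fun x => if x.1 = m then ShiftLoop.dyFun g x else 0 := by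
    funext x
    by_cases h : x.1 = m <;> simp [ShiftLoop.dyFun, h]
  rw [isSchwartz_iff]
  refine fun k => ⟨hs hg, fun i => ?_⟩
  induction i generalizing g with
  | zero =>
    obtain ⟨C, hC⟩ := isCompact_univ.exists_bound_of_continuousOn (s := (Set.univ : Set S1))
      (f := fun y => g (m, y)) (hg.continuous.comp (by fun_prop)).continuousOn
    have hC0 : 0 ≤ C := le_trans (norm_nonneg _) (hC 0 trivial)
    refine ⟨|(m : ℝ)| ^ k * C, fun x => ?_⟩
    obtain ⟨n, y⟩ := x
    by_cases h : n = m
    · subst h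
      simpa using mul_le_mul_of_nonneg_left (hC y trivial) (by positivity : 0 ≤ |(n : ℝ)| ^ k)
    · simp only [Function.iterate_zero, id, h, if_false, norm_zero, mul_zero]
      positivity
  | succ i ih => simpa only [Function.iterate_succ_apply, hd] using ih hg.dyFun

/-! ## Rapidly decreasing coefficients and coefficients independent of `n` -/

/-- The classes of smooth rapidly decreasing functions. -/
def schwartzCoef : Submodule ℂ Coef where
  carrier := {a | ∃ s, IsSchwartz s ∧ a = cls s}
  zero_mem' := by
    refine ⟨0, isSchwartz_iff.2 fun k => ?_, cls_zero.symm⟩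
    simpa using (decays_comp_snd (p := 0) contDiff_const).smul 0 |>.mul
      (isSchwartz_iff.1 (isSmooth_zero.isSchwartz_single 0) k)
  add_mem' := by
    rintro _ _ ⟨g, hg, rfl⟩ ⟨h, hh, rfl⟩
    rw [isSchwartz_iff] at hg hh
    exact ⟨_, isSchwartz_iff.2 fun k => (hg k).add (hh k), (cls_add (hg 0).1 (hh 0).1).symm⟩
  smul_mem' := by
    rintro t _ ⟨g, hg, rfl⟩
    rw [isSchwartz_iff] at hg
    exact ⟨_, isSchwartz_iff.2 fun k => (hg k).smul t, (cls_smul t (hg 0).1).symm⟩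

/-- The classes of smooth functions of `y` alone. -/
def loopCoef : Submodule ℂ Coef where
  carrier := {a | ∃ p : S1 → ℂ, ContDiff ℝ ∞ (fun y : ℝ => p (y : S1)) ∧
    a = cls (fun x => p x.2)}
  zero_mem' := ⟨0, contDiff_const, cls_zero.symm⟩
  add_mem' := by
    rintro _ _ ⟨p, hp, rfl⟩ ⟨q, hq, rfl⟩
    exact ⟨p + q, hp.add hq, (cls_add (fun _ => hp) (fun _ => hq)).symm⟩
  smul_mem' := by
    rintro t _ ⟨p, hp, rfl⟩
    exact ⟨t • p, contDiff_const.smul hp, (cls_smul t (fun _ => hp)).symm⟩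

theorem schwartzCoef_le_smoothCoef : schwartzCoef ≤ smoothCoef := by
  rintro _ ⟨s, hs, rfl⟩; exact ⟨s, hs.1, rfl⟩

theorem loopCoef_le_smoothCoef : loopCoef ≤ smoothCoef := by
  rintro _ ⟨p, hp, rfl⟩; exact ⟨_, fun _ => hp, rfl⟩

theorem shift_of_mem_loopCoef (j : ℤ) {a : Coef} (ha : a ∈ loopCoef) : shift j a = a := by
  obtain ⟨p, hp, rfl⟩ := ha
  exact shift_cls j (fun _ => hp)

theorem shift_mem_schwartzCoef (j : ℤ) {a : Coef} (ha : a ∈ schwartzCoef) :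
    shift j a ∈ schwartzCoef := by
  obtain ⟨s, hs, rfl⟩ := ha
  exact ⟨_, hs.shift j, shift_cls j hs.1⟩

theorem mul_mem_loopCoef {a b : Coef} (ha : a ∈ loopCoef) (hb : b ∈ loopCoef) :
    a * b ∈ loopCoef := by
  obtain ⟨p, hp, rfl⟩ := ha
  obtain ⟨q, hq, rfl⟩ := hb
  exact ⟨p * q, hp.mul hq, (cls_mul (fun _ => hp) (fun _ => hq)).symm⟩

theorem mul_mem_schwartzCoef {a b : Coef} (ha : a ∈ schwartzCoef) (hb : b ∈ schwartzCoef) :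
    a * b ∈ schwartzCoef := by
  obtain ⟨g, hg, rfl⟩ := ha
  obtain ⟨h, hh, rfl⟩ := hb
  rw [isSchwartz_iff] at hg hh
  exact ⟨_, isSchwartz_iff.2 fun k => (hg k).mul (hh 0), (cls_mul (hg 0).1 (hh 0).1).symm⟩

theorem loopCoef_mul_mem_schwartzCoef {a b : Coef} (ha : a ∈ loopCoef)
    (hb : b ∈ schwartzCoef) : a * b ∈ schwartzCoef := by
  obtain ⟨p, hp, rfl⟩ := ha
  obtain ⟨h, hh, rfl⟩ := hb
  rw [isSchwartz_iff] at hh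
  exact ⟨_, isSchwartz_iff.2 fun k => by simpa using (decays_comp_snd hp).mul (hh k),
    (cls_mul (fun _ => hp) (hh 0).1).symm⟩

theorem dy_mem_schwartzCoef {a : Coef} (ha : a ∈ schwartzCoef) : dy a ∈ schwartzCoef := by
  obtain ⟨s, hs, rfl⟩ := ha
  exact ⟨_, isSchwartz_iff.2 fun k => (isSchwartz_iff.1 hs k).dyFun, dy_cls hs.1⟩

theorem dy_mem_loopCoef {a : Coef} (ha : a ∈ loopCoef) : dy a ∈ loopCoef := by
  obtain ⟨p, hp, rfl⟩ := ha
  have hs : IsSmooth (fun x => p x.2) := fun _ => hp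
  exact ⟨fun y => deriv (fun s : ℝ => p (y + (s : S1))) 0, hs.dyFun 0, dy_cls hs⟩

theorem cls_mem_Linfty {g : ℤ × S1 → ℂ} (hg : Decays 0 g) : cls g ∈ Lp ℂ ⊤ mu := by
  obtain ⟨C, hC⟩ := hg.2 0
  rw [cls_eq_mk hg.1.aesm, Lp.mem_Lp_iff_memLp]
  exact (memLp_top_of_bound hg.1.aesm C (Filter.Eventually.of_forall fun x => by
    simpa using hC x)).ae_eq (AEEqFun.coeFn_mk _ _).symm

theorem IsSchwartz.integrable {g : ℤ × S1 → ℂ} (hg : IsSchwartz g) : Integrable g mu := by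
  rw [isSchwartz_iff] at hg
  obtain ⟨C, hC⟩ := (hg 0).2 0
  obtain ⟨D, hD⟩ := (hg 2).2 0
  -- The majorant uses exponent 2 off the row n = 0 and exponent 0 on it, where n² = 0 gives no
  -- bound and 1 / n² is 0 by convention.
  have hsum : Summable fun n : ℤ => ‖(if n = 0 then C else 0) + |D| * (1 / (n : ℝ) ^ 2)‖ := by
    refine Summable.norm (Summable.add ?_ ?_)
    · exact summable_of_ne_finset_zero (s := {0}) fun n hn => by simp_all
    · exact (Real.summable_one_div_int_pow.2 one_lt_two).mul_left _
  have hint := (integrable_count_iff.2 hsum).comp_fst (volume : Measure S1)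
  refine Integrable.mono' hint (hg 0).1.aesm (Filter.Eventually.of_forall fun x => ?_)
  have h0 := hC x
  have h2 := hD x
  simp only [pow_zero, one_mul, Function.iterate_zero, id, sq_abs] at h0 h2
  by_cases h : x.1 = 0
  · simpa [h] using h0
  · have hx : 0 < (x.1 : ℝ) ^ 2 := by positivity
    simp only [h, if_false, zero_add, mul_one_div]
    rw [le_div_iff₀ hx, mul_comm]
    exact h2.trans (le_abs_self D)

theorem schwartzCoef_le_L1 {a : Coef} (ha : a ∈ schwartzCoef) : a ∈ Lp ℂ 1 mu := by
  obtain ⟨s, hs, rfl⟩ := ha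
  rw [cls_eq_mk hs.1.aesm, Lp.mem_Lp_iff_memLp]
  exact (memLp_one_iff_integrable.2 hs.integrable).ae_eq (AEEqFun.coeFn_mk _ _).symm

theorem schwartzCoef_le_Linfty {a : Coef} (ha : a ∈ schwartzCoef) : a ∈ Lp ℂ ⊤ mu := by
  obtain ⟨s, hs, rfl⟩ := ha
  exact cls_mem_Linfty (isSchwartz_iff.1 hs 0)

theorem loopCoef_le_Linfty {a : Coef} (ha : a ∈ loopCoef) : a ∈ Lp ℂ ⊤ mu := by
  obtain ⟨p, hp, rfl⟩ := ha
  exact cls_mem_Linfty (decays_comp_snd hp)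

/-- The integral of a `y`-derivative vanishes. -/
theorem integ_dy {a : Coef} (ha : a ∈ schwartzCoef) : integ (dy a) = 0 := by
  obtain ⟨s, hs, rfl⟩ := ha
  have hd : IsSchwartz (dyFun s) := isSchwartz_iff.2 fun k => (isSchwartz_iff.1 hs k).dyFun
  rw [dy_cls hs.1, cls_eq_mk hd.1.aesm, integ_mk]
  have hint := hd.integrable
  unfold mu at hint ⊢
  rw [integral_prod _ hint]
  have hz (n : ℤ) : ∫ y : S1, dyFun s (n, y) = 0 := by
    rw [← AddCircle.intervalIntegral_preimage (2 * Real.pi) 0]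
    have hc : Continuous fun t : ℝ => dyFun s (n, (t : S1)) := (hd.1 n).continuous
    have hder (t : ℝ) : HasDerivAt (fun t : ℝ => s (n, (t : S1))) (dyFun s (n, (t : S1))) t := by
      have := (hs.1.differentiable n t).hasDerivAt
      rwa [← congrFun (dyFun_slice s n) t] at this
    rw [intervalIntegral.integral_eq_sub_of_hasDerivAt (fun t _ => hder t)
      (hc.intervalIntegrable _ _)]
    simp [AddCircle.coe_period]
  simp [hz]

/-! ## Nondegeneracy of the pairings -/

/-- The pairings are bilinear, so nondegeneracy is obtained by testing against the complex
conjugate, which produces ∫|f|². -/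
theorem ae_eq_zero_of_integral_mul_conj {f : ℤ × S1 → ℂ}
    (hf : Integrable (fun x => ‖f x‖ ^ 2) mu)
    (h : ∫ x, f x * (starRingEnd ℂ) (f x) ∂mu = 0) : f =ᵐ[mu] 0 := by
  have e : ∫ x, ‖f x‖ ^ 2 ∂mu = 0 := by
    have : ∀ x, f x * (starRingEnd ℂ) (f x) = ((‖f x‖ ^ 2 : ℝ) : ℂ) := fun x => by
      rw [Complex.mul_conj, Complex.normSq_eq_norm_sq]
    simp only [this] at h
    rw [integral_complex_ofReal] at h
    exact_mod_cast h
  rw [integral_eq_zero_iff_of_nonneg (fun x => by positivity) hf] at e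
  filter_upwards [e] with x hx
  simpa using hx

/-- A coefficient of positive degree need not decay, so its conjugate is cut off to one row before
it serves as a test function. -/
theorem eq_zero_of_integ_mul_schwartz {a : Coef} (ha : a ∈ smoothCoef)
    (h : ∀ t ∈ schwartzCoef, integ (a * t) = 0) : a = 0 := by
  obtain ⟨g, hg, rfl⟩ := ha
  suffices g = 0 by rw [this, cls_zero]
  funext x
  have hgc : IsSmooth (fun x => (starRingEnd ℂ) (g x)) := fun n =>
    Complex.conjCLE.contDiff.comp (hg n)
  have h1 := h _ ⟨_, hgc.isSchwartz_single x.1, rfl⟩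
  have hs := (hgc.isSchwartz_single x.1).1
  rw [← cls_mul hg hs, cls_eq_mk (hg.mul hs).aesm, integ_mk] at h1
  set f : ℤ × S1 → ℂ := fun z => if z.1 = x.1 then g z else 0 with hfdef
  have hf : IsSchwartz f := hg.isSchwartz_single x.1
  have e (z) : (g * fun z => if z.1 = x.1 then (starRingEnd ℂ) (g z) else 0) z =
      f z * (starRingEnd ℂ) (f z) := by
    by_cases hz : z.1 = x.1 <;> simp [hfdef, hz]
  simp only [e] at h1
  have hint : Integrable (fun z => ‖f z‖ ^ 2) mu := by
    have hm := isSchwartz_iff.1 hf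
    have : Integrable (f * f) mu :=
      IsSchwartz.integrable (isSchwartz_iff.2 fun k => by simpa using (hm 0).mul (hm k))
    refine this.norm.congr (Filter.Eventually.of_forall fun z => ?_)
    simp [sq]
  have h2 := ae_eq_zero_of_integral_mul_conj hint h1
  have h3 := (Continuous.ae_eq_iff_eq mu hf.1.continuous isSmooth_zero.continuous).1 h2
  simpa [hfdef] using congrFun h3 x

theorem eq_zero_of_pairW {a : Coef} (ha : a ∈ Lp ℂ 2 mu)
    (h : ∀ t ∈ Lp ℂ 2 mu, pairW a t = 0) : a = 0 := by
  have hm := Lp.mem_Lp_iff_memLp.1 ha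
  have hs : MemLp (fun x => (starRingEnd ℂ) (a x)) 2 mu := hm.star
  have ht : AEEqFun.mk _ hs.1 ∈ Lp ℂ 2 mu := hs.toLp _ |>.2
  have h1 := h _ ht
  have h2 : ∫ x, a x * (starRingEnd ℂ) (a x) ∂mu = 0 := by
    rw [← h1]
    refine integral_congr_ae ?_
    filter_upwards [AEEqFun.coeFn_mk _ hs.1] with x hx
    rw [hx]
  have h3 := ae_eq_zero_of_integral_mul_conj
    ((memLp_two_iff_integrable_sq_norm hm.1).1 hm) h2
  exact AEEqFun.ext (h3.trans AEEqFun.coeFn_zero.symm)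

/-! ## The ring of operators with degree bounded above -/

theorem opMul_eq_sum {A B : Op} {m n : ℤ} (hA : ∀ j, m < j → A j = 0)
    (hB : ∀ j, n < j → B j = 0) (k : ℤ) :
    opMul A B k = ∑ i ∈ Finset.Icc (k - n) m, A i * shift i (B (k - i)) := by
  refine finsum_eq_sum_of_support_subset _ fun i hi => ?_
  rw [Finset.coe_Icc, Set.mem_Icc]
  by_contra hc
  refine hi ?_
  by_cases h : m < i
  · simp [hA i h]
  · simp [hB (k - i) (by omega)]

theorem hasFiniteSupport_mul_shift {A B : Op} (hA : BddDegree A) (hB : BddDegree B) (k : ℤ) :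
    Function.HasFiniteSupport fun i => A i * shift i (B (k - i)) := by
  obtain ⟨m, hA⟩ := hA
  obtain ⟨n, hB⟩ := hB
  refine (Set.finite_Icc (k - n) m).subset fun i hi => ?_
  rw [Set.mem_Icc]
  by_contra hc
  refine hi ?_
  by_cases h : m < i
  · simp [hA i h]
  · simp [hB (k - i) (by omega)]

theorem BddDegree.opMul {A B : Op} (hA : BddDegree A) (hB : BddDegree B) :
    BddDegree (opMul A B) := by
  obtain ⟨m, hA⟩ := hA
  obtain ⟨n, hB⟩ := hB
  refine ⟨m + n, fun k hk => ?_⟩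
  rw [opMul_eq_sum hA hB, Finset.Icc_eq_empty (by omega), Finset.sum_empty]

theorem add_opMul {A B C : Op} (hA : BddDegree A) (hB : BddDegree B) (hC : BddDegree C) :
    opMul (A + B) C = opMul A C + opMul B C := by
  funext k
  simp only [opMul, Pi.add_apply, add_mul]
  exact finsum_add_distrib (hasFiniteSupport_mul_shift hA hC k) (hasFiniteSupport_mul_shift hB hC k)

theorem opMul_add {A B C : Op} (hA : BddDegree A) (hB : BddDegree B) (hC : BddDegree C) :
    opMul A (B + C) = opMul A B + opMul A C := by
  funext k
  simp only [opMul, Pi.add_apply, shift_add, mul_add]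
  exact finsum_add_distrib (hasFiniteSupport_mul_shift hA hB k) (hasFiniteSupport_mul_shift hA hC k)

theorem smul_opMul (t : ℂ) (A B : Op) : opMul (t • A) B = t • opMul A B := by
  funext k
  simp only [opMul, Pi.smul_apply, smul_mul_assoc]
  exact (smul_finsum t _).symm

theorem opMul_smul (t : ℂ) (A B : Op) : opMul A (t • B) = t • opMul A B := by
  funext k
  simp only [opMul, Pi.smul_apply, shift_smul, mul_smul_comm]
  exact (smul_finsum t _).symm

/-- Both sides sum the same terms over pairs of degrees taken from A and B. The degree taken from C
is then forced by k, and the three upper bounds leave finitely many pairs. -/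
theorem opMul_assoc {A B C : Op} (hA : BddDegree A) (hB : BddDegree B) (hC : BddDegree C) :
    opMul (opMul A B) C = opMul A (opMul B C) := by
  funext k
  let G : ℤ × ℤ → Coef := fun x =>
    A x.1 * shift x.1 (B x.2) * shift (x.1 + x.2) (C (k - x.1 - x.2))
  -- The pair (degree in AB, degree in A) goes to (degree in A, degree in B).
  let e : ℤ × ℤ ≃ ℤ × ℤ :=
    ⟨fun x => (x.2, x.1 - x.2), fun x => (x.1 + x.2, x.1), fun x => by simp, fun x => by simp⟩
  have hG : G.HasFiniteSupport := by
    obtain ⟨m, hA⟩ := hA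
    obtain ⟨n, hB⟩ := hB
    obtain ⟨r, hC⟩ := hC
    refine ((Set.finite_Icc (k - n - r) m).prod (Set.finite_Icc (k - m - r) n)).subset
      fun x hx => ?_
    rw [Set.mem_prod, Set.mem_Icc, Set.mem_Icc]
    by_contra hc
    refine hx ?_
    by_cases h1 : m < x.1
    · simp [G, hA _ h1]
    by_cases h2 : n < x.2
    · simp [G, hB _ h2]
    · simp [G, hC (k - x.1 - x.2) (by omega)]
  calc opMul (opMul A B) C k = ∑ᶠ i, ∑ᶠ j, G (e (i, j)) := by
        refine finsum_congr fun i => ?_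
        rw [opMul, finsum_mul' _ _ (hasFiniteSupport_mul_shift hA hB i)]
        refine finsum_congr fun j => ?_
        simp [G, e]
    _ = ∑ᶠ x, G (e x) := (finsum_curry (fun x => G (e x)) (hG.preimage e.injective.injOn)).symm
    _ = ∑ᶠ x, G x := finsum_comp_equiv e
    _ = ∑ᶠ i, ∑ᶠ j, G (i, j) := finsum_curry G hG
    _ = opMul A (opMul B C) k := by
        refine finsum_congr fun i => ?_
        have hf := hasFiniteSupport_mul_shift hB hC (k - i)
        have hs : shift i (opMul B C (k - i)) =
            ∑ᶠ j, shift i (B j * shift j (C (k - i - j))) :=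
          AddMonoidHom.map_finsum (shiftHom i).toAddMonoidHom hf
        rw [hs, mul_finsum' _ _ (hf.subset fun j hj h => hj ?_)]
        · refine finsum_congr fun j => ?_
          simp [G, mul_assoc, shift_mul, shift_shift]
        · simp only at h
          simp [h]

/-- The operators with degree bounded above. -/
def boundedOps : Submodule ℂ Op where
  carrier := {A | BddDegree A}
  zero_mem' := ⟨0, fun _ _ => rfl⟩
  add_mem' := by
    rintro A B ⟨m, hA⟩ ⟨n, hB⟩
    refine ⟨max m n, fun j hj => ?_⟩
    rw [Pi.add_apply, hA j (by omega), hB j (by omega), add_zero]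
  smul_mem' := by
    rintro t A ⟨m, hA⟩
    exact ⟨m, fun j hj => by rw [Pi.smul_apply, hA j hj, smul_zero]⟩

theorem mem_boundedOps {A : Op} : A ∈ boundedOps ↔ BddDegree A := Iff.rfl

noncomputable instance : Mul boundedOps := ⟨fun A B => ⟨opMul A B, A.2.opMul B.2⟩⟩

/-- With the ring laws available, the Jacobi identity for commutators is a formal expansion. -/
noncomputable instance : NonUnitalRing boundedOps :=
  { (inferInstance : AddCommGroup boundedOps), (inferInstance : Mul boundedOps) with
    left_distrib := fun A B C => Subtype.ext (opMul_add A.2 B.2 C.2)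
    right_distrib := fun A B C => Subtype.ext (add_opMul A.2 B.2 C.2)
    zero_mul := fun A => Subtype.ext <| show opMul 0 A = 0 by simpa using smul_opMul 0 0 A
    mul_zero := fun A => Subtype.ext <| show opMul A 0 = 0 by simpa using opMul_smul 0 A 0
    mul_assoc := fun A B C => Subtype.ext (opMul_assoc A.2 B.2 C.2) }

theorem opComm_add {A B C : Op} (hA : A ∈ boundedOps) (hB : B ∈ boundedOps)
    (hC : C ∈ boundedOps) : opComm A (B + C) = opComm A B + opComm A C := by
  simp only [opComm, opMul_add hA hB hC, add_opMul hB hC hA]; abel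

theorem add_opComm {A B C : Op} (hA : A ∈ boundedOps) (hB : B ∈ boundedOps)
    (hC : C ∈ boundedOps) : opComm (A + B) C = opComm A C + opComm B C := by
  simp only [opComm, opMul_add hC hA hB, add_opMul hA hB hC]; abel

theorem opComm_smul (t : ℂ) (A B : Op) : opComm A (t • B) = t • opComm A B := by
  simp only [opComm, opMul_smul, smul_opMul, smul_sub]

theorem smul_opComm (t : ℂ) (A B : Op) : opComm (t • A) B = t • opComm A B := by
  simp only [opComm, opMul_smul, smul_opMul, smul_sub]

theorem opComm_anticomm (A B : Op) : opComm A B = -opComm B A := by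
  simp only [opComm, neg_sub]

theorem opComm_jacobi {A B C : Op} (hA : A ∈ boundedOps) (hB : B ∈ boundedOps)
    (hC : C ∈ boundedOps) :
    opComm A (opComm B C) + opComm B (opComm C A) + opComm C (opComm A B) = 0 := by
  lift A to boundedOps using hA
  lift B to boundedOps using hB
  lift C to boundedOps using hC
  have h : (A * (B * C - C * B) - (B * C - C * B) * A) +
      (B * (C * A - A * C) - (C * A - A * C) * B) +
      (C * (A * B - B * A) - (A * B - B * A) * C) = 0 := by
    simp only [mul_sub, sub_mul, mul_assoc]; abel
  exact congrArg Subtype.val h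

/-! ## Parts of an operator -/

theorem posPart_add_negPart (A : Op) : posPart A + negPart A = A := by
  funext j
  by_cases h : 0 ≤ j
  · simp [posPart, negPart, h, not_lt.2 h]
  · simp [posPart, negPart, h, not_le.1 h]

theorem posPart_add (A B : Op) : posPart (A + B) = posPart A + posPart B := by
  funext j; by_cases h : 0 ≤ j <;> simp [posPart, h]

theorem posPart_smul (t : ℂ) (A : Op) : posPart (t • A) = t • posPart A := by
  funext j; by_cases h : 0 ≤ j <;> simp [posPart, h]

theorem strictPart_add (A B : Op) : strictPart (A + B) = strictPart A + strictPart B := by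
  funext j; by_cases h : 0 < j <;> simp [strictPart, h]

theorem strictPart_smul (t : ℂ) (A : Op) : strictPart (t • A) = t • strictPart A := by
  funext j; by_cases h : 0 < j <;> simp [strictPart, h]

theorem posPart_apply_of_neg (A : Op) {j : ℤ} (h : j < 0) : posPart A j = 0 := by
  simp [posPart, not_le.2 h]

theorem negPart_apply_of_nonneg (A : Op) {j : ℤ} (h : 0 ≤ j) : negPart A j = 0 := by
  simp [negPart, not_lt.2 h]

theorem posPart_eq_self {A : Op} (h : ∀ j < 0, A j = 0) : posPart A = A := by
  funext j
  by_cases hj : 0 ≤ j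
  · simp [posPart, hj]
  · simp [posPart, hj, h j (by omega)]

theorem posPart_eq_zero {A : Op} (h : ∀ j, 0 ≤ j → A j = 0) : posPart A = 0 := by
  funext j
  by_cases hj : 0 ≤ j
  · simp [posPart, hj, h j hj]
  · simp [posPart, hj]

/-- Degrees ≥ 0 and degrees < 0 are each closed under multiplication; the ℛ-deformation depends on
this splitting into two subalgebras. -/
theorem opMul_posPart_apply_of_neg (A B : Op) {k : ℤ} (hk : k < 0) :
    opMul (posPart A) (posPart B) k = 0 := by
  refine finsum_eq_zero_of_forall_eq_zero fun i => ?_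
  by_cases h : i < 0
  · rw [posPart_apply_of_neg A h, zero_mul]
  · rw [posPart_apply_of_neg B (by omega), shift_zero, mul_zero]

theorem opMul_negPart_apply_of_nonneg (A B : Op) {k : ℤ} (hk : 0 ≤ k) :
    opMul (negPart A) (negPart B) k = 0 := by
  refine finsum_eq_zero_of_forall_eq_zero fun i => ?_
  by_cases h : i < 0
  · rw [negPart_apply_of_nonneg B (by omega), shift_zero, mul_zero]
  · rw [negPart_apply_of_nonneg A (by omega), zero_mul]

/-! ## The loop algebra and its dual as graded spaces -/

/-- A shift-invariant space of coefficients that contains the rapidly decreasing ones and absorbs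
products with rapidly decreasing coefficients and with coefficients independent of `n`. -/
structure IsCoefIdeal (J : Submodule ℂ Coef) : Prop where
  schwartz_le : schwartzCoef ≤ J
  shift_mem : ∀ j, ∀ a ∈ J, shift j a ∈ J
  schwartz_mul : ∀ a ∈ schwartzCoef, ∀ b ∈ J, a * b ∈ J
  loop_mul : ∀ a ∈ loopCoef, ∀ b ∈ J, a * b ∈ J

/-- The integrable coefficients. -/
noncomputable def integrableCoef : Submodule ℂ Coef := Lp.LpSubmodule ℂ ℂ 1 mu

theorem isCoefIdeal_schwartzCoef : IsCoefIdeal schwartzCoef where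
  schwartz_le := le_rfl
  shift_mem j _ := shift_mem_schwartzCoef j
  schwartz_mul _ ha _ := mul_mem_schwartzCoef ha
  loop_mul _ ha _ := loopCoef_mul_mem_schwartzCoef ha

theorem isCoefIdeal_integrableCoef : IsCoefIdeal integrableCoef where
  schwartz_le _ := schwartzCoef_le_L1
  shift_mem j _ := shift_mem_Lp j
  schwartz_mul _ ha _ hb := mul_mem_Lp (p := ⊤) (schwartzCoef_le_Linfty ha) hb
  loop_mul _ ha _ hb := mul_mem_Lp (p := ⊤) (loopCoef_le_Linfty ha) hb

/-- The coefficients allowed in degree `j`. -/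
noncomputable def gradedCoef (J : Submodule ℂ Coef) (j : ℤ) : Submodule ℂ Coef :=
  if 0 < j then loopCoef ⊔ J else J

theorem gradedCoef_of_pos (J : Submodule ℂ Coef) {j : ℤ} (h : 0 < j) :
    gradedCoef J j = loopCoef ⊔ J := if_pos h

theorem gradedCoef_of_nonpos (J : Submodule ℂ Coef) {j : ℤ} (h : j ≤ 0) :
    gradedCoef J j = J := if_neg (not_lt.2 h)

theorem le_gradedCoef (J : Submodule ℂ Coef) (j : ℤ) : J ≤ gradedCoef J j := by
  unfold gradedCoef
  split_ifs
  · exact le_sup_right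
  · exact le_rfl

theorem gradedCoef_mono {J K : Submodule ℂ Coef} (h : J ≤ K) (j : ℤ) :
    gradedCoef J j ≤ gradedCoef K j := by
  unfold gradedCoef
  split_ifs
  · exact sup_le_sup_left h _
  · exact h

theorem IsCoefIdeal.shift_mem_graded {J : Submodule ℂ Coef} (hJ : IsCoefIdeal J) (i : ℤ) {j : ℤ}
    {a : Coef} (ha : a ∈ gradedCoef J j) :
    shift i a ∈ gradedCoef J j := by
  rcases lt_or_ge 0 j with h | h
  · rw [gradedCoef_of_pos J h, Submodule.mem_sup] at *
    obtain ⟨p, hp, s, hs, rfl⟩ := ha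
    refine ⟨p, hp, shift i s, hJ.shift_mem i s hs, ?_⟩
    rw [shift_add, shift_of_mem_loopCoef i hp]
  · rw [gradedCoef_of_nonpos J h] at *
    exact hJ.shift_mem i a ha

/-- The only product outside J is that of two terms independent of n. It needs both degrees
positive, and then the total degree is positive and such a term is allowed. In total degree 0 the
product lies in J, which is why traces converge. -/
theorem IsCoefIdeal.mul_mem_graded {J : Submodule ℂ Coef} (hJ : IsCoefIdeal J) {i j : ℤ}
    {a b : Coef} (ha : a ∈ gradedCoef schwartzCoef i) (hb : b ∈ gradedCoef J j) :
    a * b ∈ gradedCoef J (i + j) := by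
  have hsl {s p : Coef} (hs : s ∈ schwartzCoef) (hp : p ∈ loopCoef) : s * p ∈ J := by
    rw [mul_comm s p]
    exact hJ.schwartz_le (loopCoef_mul_mem_schwartzCoef hp hs)
  rcases lt_or_ge 0 i with hi | hi <;> rcases lt_or_ge 0 j with hj | hj
  · rw [gradedCoef_of_pos _ hi, Submodule.mem_sup] at ha
    rw [gradedCoef_of_pos _ hj, Submodule.mem_sup] at hb
    rw [gradedCoef_of_pos _ (by omega), Submodule.mem_sup]
    obtain ⟨p, hp, s, hs, rfl⟩ := ha
    obtain ⟨q, hq, b, hb, rfl⟩ := hb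
    exact ⟨p * q, mul_mem_loopCoef hp hq, p * b + s * q + s * b, add_mem (add_mem
      (hJ.loop_mul p hp b hb) (hsl hs hq)) (hJ.schwartz_mul s hs b hb), by ring⟩
  · rw [gradedCoef_of_pos _ hi, Submodule.mem_sup] at ha
    rw [gradedCoef_of_nonpos _ hj] at hb
    obtain ⟨p, hp, s, hs, rfl⟩ := ha
    rw [add_mul]
    exact le_gradedCoef J _ (add_mem (hJ.loop_mul p hp b hb) (hJ.schwartz_mul s hs b hb))
  · rw [gradedCoef_of_nonpos _ hi] at ha
    rw [gradedCoef_of_pos _ hj, Submodule.mem_sup] at hb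
    obtain ⟨q, hq, b, hb, rfl⟩ := hb
    rw [mul_add]
    exact le_gradedCoef J _ (add_mem (hsl ha hq) (hJ.schwartz_mul a ha b hb))
  · rw [gradedCoef_of_nonpos _ hi] at ha
    rw [gradedCoef_of_nonpos _ hj] at hb
    exact le_gradedCoef J _ (hJ.schwartz_mul a ha b hb)

/-- Operators of bounded degree with coefficients in the graded space of `J`. -/
noncomputable def gradedOps (J : Submodule ℂ Coef) : Submodule ℂ Op :=
  boundedOps ⊓ Submodule.pi Set.univ (gradedCoef J)

theorem mem_gradedOps {J : Submodule ℂ Coef} {A : Op} :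
    A ∈ gradedOps J ↔ BddDegree A ∧ ∀ j, A j ∈ gradedCoef J j := by
  simp [gradedOps, Submodule.mem_pi, mem_boundedOps]

theorem gradedOps_le_boundedOps (J : Submodule ℂ Coef) : gradedOps J ≤ boundedOps := inf_le_left

theorem gradedOps_mono {J K : Submodule ℂ Coef} (h : J ≤ K) : gradedOps J ≤ gradedOps K :=
  fun _ hA => mem_gradedOps.2 ⟨(mem_gradedOps.1 hA).1, fun j =>
    gradedCoef_mono h j ((mem_gradedOps.1 hA).2 j)⟩

/-- The loop algebra as a subspace. -/
noncomputable abbrev loopOps : Submodule ℂ Op := gradedOps schwartzCoef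

/-- The enlarged dual as a subspace. -/
noncomputable abbrev dualOps : Submodule ℂ Op := gradedOps integrableCoef

theorem mem_loopOps {A : Op} : A ∈ loopOps ↔ A ∈ loopAlg := by
  rw [mem_gradedOps]
  refine and_congr Iff.rfl (forall_congr' fun j => ?_)
  have hadd {p : S1 → ℂ} {s : ℤ × S1 → ℂ} (hp : ContDiff ℝ ∞ fun y : ℝ => p (y : S1))
      (hs : IsSchwartz s) : cls (fun x => p x.2 + s x) = cls (fun x => p x.2) + cls s :=
    cls_add (fun _ => hp) hs.1
  constructor
  · intro h
    rcases lt_or_ge 0 j with hj | hj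
    · rw [gradedCoef_of_pos _ hj, Submodule.mem_sup] at h
      obtain ⟨_, ⟨p, hp, rfl⟩, _, ⟨s, hs, rfl⟩, e⟩ := h
      exact ⟨p, s, hp, fun h => absurd hj (not_lt.2 h), hs, by rw [hadd hp hs, e]⟩
    · rw [gradedCoef_of_nonpos _ hj] at h
      obtain ⟨s, hs, e⟩ := h
      exact ⟨0, s, contDiff_const, fun _ => rfl, hs, by simpa using e⟩
  · rintro ⟨p, s, hp, h0, hs, e⟩
    rw [e, hadd hp hs]
    rcases lt_or_ge 0 j with hj | hj
    · rw [gradedCoef_of_pos _ hj]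
      exact Submodule.add_mem_sup ⟨p, hp, rfl⟩ ⟨s, hs, rfl⟩
    · rw [gradedCoef_of_nonpos _ hj, h0 hj]
      exact add_mem (by simpa using cls_zero ▸ zero_mem schwartzCoef) ⟨s, hs, rfl⟩

theorem mem_dualOps {A : Op} : A ∈ dualOps ↔ A ∈ dualAlg := by
  rw [mem_gradedOps]
  refine and_congr Iff.rfl (forall_congr' fun j => ?_)
  constructor
  · intro h
    rcases lt_or_ge 0 j with hj | hj
    · rw [gradedCoef_of_pos _ hj, Submodule.mem_sup] at h
      obtain ⟨_, ⟨p, hp, rfl⟩, b, hb, e⟩ := h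
      exact ⟨p, b, hp, fun h => absurd hj (not_lt.2 h), mem_L1_iff.1 hb, e.symm⟩
    · rw [gradedCoef_of_nonpos _ hj] at h
      refine ⟨0, A j, contDiff_const, fun _ => rfl, mem_L1_iff.1 h, ?_⟩
      exact (by rw [cls_zero, zero_add] : A j = cls 0 + A j)
  · rintro ⟨p, b, hp, h0, hb, e⟩
    rw [e]
    rcases lt_or_ge 0 j with hj | hj
    · rw [gradedCoef_of_pos _ hj]
      exact Submodule.add_mem_sup ⟨p, hp, rfl⟩ (mem_L1_iff.2 hb)
    · rw [gradedCoef_of_nonpos _ hj, h0 hj]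
      refine add_mem ?_ (mem_L1_iff.2 hb)
      exact (cls_zero ▸ zero_mem integrableCoef : cls 0 ∈ integrableCoef)

theorem loopOps_le_dualOps : loopOps ≤ dualOps :=
  gradedOps_mono isCoefIdeal_integrableCoef.schwartz_le

theorem loopOps_le_boundedOps : loopOps ≤ boundedOps := gradedOps_le_boundedOps _

theorem dualOps_le_boundedOps : dualOps ≤ boundedOps := gradedOps_le_boundedOps _

theorem IsCoefIdeal.opMul_mem {J : Submodule ℂ Coef} (hJ : IsCoefIdeal J) {A B : Op}
    (hA : A ∈ loopOps) (hB : B ∈ gradedOps J) : opMul A B ∈ gradedOps J := by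
  rw [mem_gradedOps] at *
  refine ⟨hA.1.opMul hB.1, fun k => ?_⟩
  obtain ⟨m, hm⟩ := hA.1
  obtain ⟨n, hn⟩ := hB.1
  rw [opMul_eq_sum hm hn]
  refine sum_mem fun i _ => ?_
  have := hJ.mul_mem_graded (hA.2 i) (hJ.shift_mem_graded i (hB.2 (k - i)))
  rwa [add_sub_cancel] at this

theorem IsCoefIdeal.opMul_mem' {J : Submodule ℂ Coef} (hJ : IsCoefIdeal J) {A B : Op}
    (hA : A ∈ gradedOps J) (hB : B ∈ loopOps) : opMul A B ∈ gradedOps J := by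
  rw [mem_gradedOps] at *
  refine ⟨hA.1.opMul hB.1, fun k => ?_⟩
  obtain ⟨m, hm⟩ := hA.1
  obtain ⟨n, hn⟩ := hB.1
  rw [opMul_eq_sum hm hn]
  refine sum_mem fun i _ => ?_
  have := hJ.mul_mem_graded (isCoefIdeal_schwartzCoef.shift_mem_graded i (hB.2 (k - i))) (hA.2 i)
  rwa [sub_add_cancel, mul_comm (shift i (B (k - i)))] at this

theorem opMul_mem_loopOps {A B : Op} (hA : A ∈ loopOps) (hB : B ∈ loopOps) :
    opMul A B ∈ loopOps := isCoefIdeal_schwartzCoef.opMul_mem hA hB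

theorem opComm_mem_loopOps {A B : Op} (hA : A ∈ loopOps) (hB : B ∈ loopOps) :
    opComm A B ∈ loopOps := sub_mem (opMul_mem_loopOps hA hB) (opMul_mem_loopOps hB hA)

theorem opMul_mem_dualOps {A B : Op} (hA : A ∈ loopOps) (hB : B ∈ dualOps) :
    opMul A B ∈ dualOps := isCoefIdeal_integrableCoef.opMul_mem hA hB

theorem opMul_mem_dualOps' {A B : Op} (hA : A ∈ dualOps) (hB : B ∈ loopOps) :
    opMul A B ∈ dualOps := isCoefIdeal_integrableCoef.opMul_mem' hA hB

theorem opComm_mem_dualOps {A B : Op} (hA : A ∈ dualOps) (hB : B ∈ loopOps) :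
    opComm A B ∈ dualOps := sub_mem (opMul_mem_dualOps' hA hB) (opMul_mem_dualOps hB hA)

theorem restrict_mem_gradedOps {J : Submodule ℂ Coef} (q : ℤ → Prop) [DecidablePred q] {A : Op}
    (hA : A ∈ gradedOps J) : (fun j => if q j then A j else 0) ∈ gradedOps J := by
  rw [mem_gradedOps] at *
  obtain ⟨m, hm⟩ := hA.1
  refine ⟨⟨m, fun j hj => by simp [hm j hj]⟩, fun j => ?_⟩
  split_ifs
  · exact hA.2 j
  · exact zero_mem _

theorem posPart_mem {J : Submodule ℂ Coef} {A : Op} (hA : A ∈ gradedOps J) :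
    posPart A ∈ gradedOps J := restrict_mem_gradedOps _ hA

theorem negPart_mem {J : Submodule ℂ Coef} {A : Op} (hA : A ∈ gradedOps J) :
    negPart A ∈ gradedOps J := restrict_mem_gradedOps _ hA

theorem strictPart_mem {J : Submodule ℂ Coef} {A : Op} (hA : A ∈ gradedOps J) :
    strictPart A ∈ gradedOps J := restrict_mem_gradedOps _ hA

theorem coef_mem_smoothCoef {A : Op} (hA : A ∈ loopOps) (j : ℤ) : A j ∈ smoothCoef := by
  refine (?_ : gradedCoef schwartzCoef j ≤ smoothCoef) ((mem_gradedOps.1 hA).2 j)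
  unfold gradedCoef
  split_ifs
  · exact sup_le loopCoef_le_smoothCoef schwartzCoef_le_smoothCoef
  · exact schwartzCoef_le_smoothCoef

theorem coef_mem_Linfty {A : Op} (hA : A ∈ loopOps) (j : ℤ) : A j ∈ Lp ℂ ⊤ mu := by
  refine (?_ : gradedCoef schwartzCoef j ≤ Lp.LpSubmodule ℂ ℂ ⊤ mu) ((mem_gradedOps.1 hA).2 j)
  unfold gradedCoef
  split_ifs
  · exact sup_le (fun _ => loopCoef_le_Linfty) (fun _ => schwartzCoef_le_Linfty)
  · exact fun _ => schwartzCoef_le_Linfty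

theorem dyOp_mem_loopOps {A : Op} (hA : A ∈ loopOps) : dyOp A ∈ loopOps := by
  rw [mem_gradedOps] at *
  obtain ⟨m, hm⟩ := hA.1
  refine ⟨⟨m, fun j hj => by simp [dyOp, hm j hj]⟩, fun j => ?_⟩
  have h := hA.2 j
  rcases lt_or_ge 0 j with hj | hj
  · rw [gradedCoef_of_pos _ hj, Submodule.mem_sup] at h ⊢
    obtain ⟨p, hp, s, hs, e⟩ := h
    refine ⟨_, dy_mem_loopCoef hp, _, dy_mem_schwartzCoef hs, ?_⟩
    rw [dyOp, ← e, dy_add (loopCoef_le_smoothCoef hp) (schwartzCoef_le_smoothCoef hs)]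
  · rw [gradedCoef_of_nonpos _ hj] at h ⊢
    exact dy_mem_schwartzCoef h

/-- Membership in the loop algebra matters: `dy` takes a default value on classes without a smooth
representative and is computed only on smooth ones. -/
theorem dyOp_add {A B : Op} (hA : A ∈ loopOps) (hB : B ∈ loopOps) :
    dyOp (A + B) = dyOp A + dyOp B :=
  funext fun j => dy_add (coef_mem_smoothCoef hA j) (coef_mem_smoothCoef hB j)

theorem dyOp_smul (t : ℂ) {A : Op} (hA : A ∈ loopOps) : dyOp (t • A) = t • dyOp A :=
  funext fun j => dy_smul t (coef_mem_smoothCoef hA j)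

theorem dyOp_neg {A : Op} (hA : A ∈ loopOps) : dyOp (-A) = -dyOp A := by
  simpa using dyOp_smul (-1) hA

theorem dyOp_sub {A B : Op} (hA : A ∈ loopOps) (hB : B ∈ loopOps) :
    dyOp (A - B) = dyOp A - dyOp B := by
  rw [sub_eq_add_neg, dyOp_add hA (neg_mem hB), dyOp_neg hB, sub_eq_add_neg]

theorem dyOp_opMul {A B : Op} (hA : A ∈ loopOps) (hB : B ∈ loopOps) :
    dyOp (opMul A B) = opMul (dyOp A) B + opMul A (dyOp B) := by
  obtain ⟨m, hm⟩ := (mem_gradedOps.1 hA).1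
  obtain ⟨n, hn⟩ := (mem_gradedOps.1 hB).1
  have hm' : ∀ j, m < j → dyOp A j = 0 := fun j hj => by simp [dyOp, hm j hj]
  have hn' : ∀ j, n < j → dyOp B j = 0 := fun j hj => by simp [dyOp, hn j hj]
  have sA := coef_mem_smoothCoef hA
  have sB := coef_mem_smoothCoef hB
  funext k
  rw [Pi.add_apply, opMul_eq_sum hm' hn, opMul_eq_sum hm hn', ← Finset.sum_add_distrib, dyOp,
    opMul_eq_sum hm hn, dy_sum _ _ fun i _ =>
      mul_mem_smoothCoef (sA i) (shift_mem_smoothCoef i (sB (k - i)))]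
  refine Finset.sum_congr rfl fun i _ => ?_
  rw [dy_mul (sA i) (shift_mem_smoothCoef i (sB (k - i))), dy_shift i (sB _)]
  rfl

theorem dyOp_opComm {A B : Op} (hA : A ∈ loopOps) (hB : B ∈ loopOps) :
    dyOp (opComm A B) = opComm (dyOp A) B + opComm A (dyOp B) := by
  rw [opComm, dyOp_sub (opMul_mem_loopOps hA hB) (opMul_mem_loopOps hB hA), dyOp_opMul hA hB,
    dyOp_opMul hB hA, opComm, opComm]
  abel

theorem laxComm_mem_dualOps {l : Op} (hl : l ∈ dualOps) (c : ℂ) {A : Op} (hA : A ∈ loopOps) :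
    laxComm l c A ∈ dualOps :=
  sub_mem (opComm_mem_dualOps hl hA)
    (Submodule.smul_mem _ c (loopOps_le_dualOps (dyOp_mem_loopOps hA)))

/-! ## The invariant form and the cocycle -/

theorem coef_zero_mem_L1 {A : Op} (hA : A ∈ dualOps) : A 0 ∈ Lp ℂ 1 mu := by
  have := (mem_gradedOps.1 hA).2 0
  rwa [gradedCoef_of_nonpos _ le_rfl] at this

theorem intTr_add {A B : Op} (hA : A ∈ dualOps) (hB : B ∈ dualOps) :
    intTr (A + B) = intTr A + intTr B :=
  integ_add (coef_zero_mem_L1 hA) (coef_zero_mem_L1 hB)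

theorem intTr_smul (t : ℂ) (A : Op) : intTr (t • A) = t * intTr A := integ_smul t (A 0)

theorem form_smul_left (t : ℂ) (A B : Op) : form (t • A) B = t * form A B := by
  rw [form, smul_opMul, intTr_smul, form]

theorem form_smul_right (t : ℂ) (A B : Op) : form A (t • B) = t * form A B := by
  rw [form, opMul_smul, intTr_smul, form]

theorem form_neg_left (A B : Op) : form (-A) B = -form A B := by
  simpa using form_smul_left (-1) A B

theorem form_neg_right (A B : Op) : form A (-B) = -form A B := by
  simpa using form_smul_right (-1) A B

@[simp] theorem form_zero_left (A : Op) : form 0 A = 0 := by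
  simpa using form_smul_left 0 0 A

@[simp] theorem form_zero_right (A : Op) : form A 0 = 0 := by
  simpa using form_smul_right 0 A 0

theorem form_add_right {A B C : Op} (hA : A ∈ loopOps) (hB : B ∈ dualOps) (hC : C ∈ dualOps) :
    form A (B + C) = form A B + form A C := by
  rw [form, opMul_add (loopOps_le_boundedOps hA) (dualOps_le_boundedOps hB)
    (dualOps_le_boundedOps hC), intTr_add (opMul_mem_dualOps hA hB) (opMul_mem_dualOps hA hC)]
  rfl

theorem form_add_left {A B C : Op} (hA : A ∈ loopOps) (hB : B ∈ loopOps) (hC : C ∈ dualOps) :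
    form (A + B) C = form A C + form B C := by
  rw [form, add_opMul (loopOps_le_boundedOps hA) (loopOps_le_boundedOps hB)
    (dualOps_le_boundedOps hC), intTr_add (opMul_mem_dualOps hA hC) (opMul_mem_dualOps hB hC)]
  rfl

theorem form_sub_right {A B C : Op} (hA : A ∈ loopOps) (hB : B ∈ dualOps) (hC : C ∈ dualOps) :
    form A (B - C) = form A B - form A C := by
  rw [sub_eq_add_neg, form_add_right hA hB (neg_mem hC), form_neg_right, sub_eq_add_neg]

theorem form_sub_left {A B C : Op} (hA : A ∈ loopOps) (hB : B ∈ loopOps) (hC : C ∈ dualOps) :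
    form (A - B) C = form A C - form B C := by
  rw [sub_eq_add_neg, form_add_left hA (neg_mem hB) hC, form_neg_left, sub_eq_add_neg]

theorem form_sum_right {ι : Type*} (s : Finset ι) {A : Op} (hA : A ∈ loopOps) (B : ι → Op)
    (hB : ∀ i, B i ∈ dualOps) : form A (∑ i ∈ s, B i) = ∑ i ∈ s, form A (B i) := by
  classical
  induction s using Finset.induction_on with
  | empty => simp
  | insert i s hi ih =>
    rw [Finset.sum_insert hi, Finset.sum_insert hi,
      form_add_right hA (hB i) (sum_mem fun k _ => hB k), ih]

/-- Shifting the i-th summand of (AB)₀ by -i gives the (-i)-th summand of (BA)₀, and the integral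
does not see the shift. -/
theorem form_comm {A B : Op} (hA : A ∈ loopOps) (hB : B ∈ dualOps) : form A B = form B A := by
  rw [mem_gradedOps] at hA hB
  obtain ⟨m, hm⟩ := hA.1
  obtain ⟨n, hn⟩ := hB.1
  have hmem (i : ℤ) : A i * shift i (B (0 - i)) ∈ Lp ℂ 1 mu := by
    have h := isCoefIdeal_integrableCoef
    have := h.mul_mem_graded (hA.2 i) (h.shift_mem_graded i (hB.2 (0 - i)))
    rwa [add_sub_cancel, gradedCoef_of_nonpos _ le_rfl] at this
  have hsw (i : ℤ) : shift (-i) (A i * shift i (B (0 - i))) = B (-i) * shift (-i) (A (0 - -i)) := by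
    rw [shift_mul, shift_shift, neg_add_cancel, shift_by_zero, mul_comm, zero_sub, zero_sub,
      neg_neg]
  change integ (opMul A B 0) = integ (opMul B A 0)
  rw [opMul_eq_sum hm hn, opMul_eq_sum hn hm, integ_sum _ _ fun i _ => hmem i, integ_sum _ _
    fun i _ => by
      have := shift_mem_Lp (-(-i)) (hmem (-i))
      rw [hsw] at this
      simpa only [neg_neg] using this]
  refine Finset.sum_nbij' (fun i => -i) (fun i => -i) ?_ ?_ ?_ ?_ ?_
  · intro i hi; rw [Finset.mem_Icc] at *; omega
  · intro i hi; rw [Finset.mem_Icc] at *; omega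
  · simp
  · simp
  · intro i _
    rw [← integ_shift (-i), hsw]

theorem form_opMul_left {A B C : Op} (hA : A ∈ boundedOps) (hB : B ∈ boundedOps)
    (hC : C ∈ boundedOps) : form (opMul A B) C = form A (opMul B C) := by
  rw [form, form, opMul_assoc hA hB hC]

/-- Invariance of the form, arranged so that l is the only factor outside the loop algebra in each
product. -/
theorem form_opComm {A B l : Op} (hA : A ∈ loopOps) (hB : B ∈ loopOps) (hl : l ∈ dualOps) :
    form A (opComm l B) = form (opComm B A) l := by
  have bA := loopOps_le_boundedOps hA
  have bB := loopOps_le_boundedOps hB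
  have bl := dualOps_le_boundedOps hl
  rw [opComm, form_sub_right hA (opMul_mem_dualOps' hl hB) (opMul_mem_dualOps hB hl), opComm,
    form_sub_left (opMul_mem_loopOps hB hA) (opMul_mem_loopOps hA hB) hl,
    ← form_opMul_left bA bl bB, ← form_comm hB (opMul_mem_dualOps hA hl),
    form_opMul_left bB bA bl, form_opMul_left bA bB bl]

theorem omega_add_left {A B C : Op} (hA : A ∈ loopOps) (hB : B ∈ loopOps) (hC : C ∈ loopOps) :
    omega (A + B) C = omega A C + omega B C :=
  form_add_left hA hB (loopOps_le_dualOps (dyOp_mem_loopOps hC))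

theorem omega_add_right {A B C : Op} (hA : A ∈ loopOps) (hB : B ∈ loopOps) (hC : C ∈ loopOps) :
    omega A (B + C) = omega A B + omega A C := by
  rw [omega, dyOp_add hB hC, form_add_right hA (loopOps_le_dualOps (dyOp_mem_loopOps hB))
    (loopOps_le_dualOps (dyOp_mem_loopOps hC))]
  rfl

theorem omega_smul_left (t : ℂ) (A B : Op) : omega (t • A) B = t * omega A B :=
  form_smul_left t A _

theorem omega_smul_right (t : ℂ) (A : Op) {B : Op} (hB : B ∈ loopOps) :
    omega A (t • B) = t * omega A B := by
  rw [omega, dyOp_smul t hB, form_smul_right, omega]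

theorem omega_neg_left (A B : Op) : omega (-A) B = -omega A B := form_neg_left A _

theorem omega_neg_right (A : Op) {B : Op} (hB : B ∈ loopOps) : omega A (-B) = -omega A B := by
  rw [omega, dyOp_neg hB, form_neg_right, omega]

/-- Integration by parts: the trace of ∂(AB) integrates to zero over the circle. -/
theorem omega_skew {A B : Op} (hA : A ∈ loopOps) (hB : B ∈ loopOps) :
    omega A B = -omega B A := by
  have dA := dyOp_mem_loopOps hA
  have dB := dyOp_mem_loopOps hB
  have h : intTr (dyOp (opMul A B)) = 0 := by
    refine integ_dy ?_
    have := (mem_gradedOps.1 (opMul_mem_loopOps hA hB)).2 0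
    rwa [gradedCoef_of_nonpos _ le_rfl] at this
  rw [dyOp_opMul hA hB, intTr_add (loopOps_le_dualOps (opMul_mem_loopOps dA hB))
    (loopOps_le_dualOps (opMul_mem_loopOps hA dB))] at h
  have e := form_comm dA (loopOps_le_dualOps hB)
  unfold omega
  unfold form at *
  linear_combination h - e

/-- As ∂ is a derivation and the form is invariant, ω(A, [B, C]) = ω([C, A], B) - ω([B, A], C);
skewness then cancels the other two terms. -/
theorem omega_cocycle {A B C : Op} (hA : A ∈ loopOps) (hB : B ∈ loopOps) (hC : C ∈ loopOps) :
    omega A (opComm B C) + omega B (opComm C A) + omega C (opComm A B) = 0 := by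
  have dB := loopOps_le_dualOps (dyOp_mem_loopOps hB)
  have dC := loopOps_le_dualOps (dyOp_mem_loopOps hC)
  have h1 : omega A (opComm B C) = omega (opComm C A) B - omega (opComm B A) C := by
    rw [omega, dyOp_opComm hB hC, opComm_anticomm B, form_add_right hA
      (opComm_mem_dualOps dB hC) (neg_mem (opComm_mem_dualOps dC hB)), form_neg_right,
      form_opComm hA hC dB, form_opComm hA hB dC, omega, omega, sub_eq_add_neg]
  have h2 := omega_skew hB (opComm_mem_loopOps hC hA)
  have h3 := omega_skew hC (opComm_mem_loopOps hA hB)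
  have h4 : omega (opComm A B) C = -omega (opComm B A) C := by
    rw [opComm_anticomm, omega_neg_left]
  linear_combination h1 + h2 + h3 - h4

/-! ## The deformed bracket -/

/-- The two halves of the deformed commutator contribute the mixed terms [A₊, B₋] and [A₋, B₊] with
opposite signs. What remains is the direct sum of the two subalgebras, with the bracket reversed on
the negative one. -/
theorem rComm_eq {A B : Op} (hA : A ∈ loopOps) (hB : B ∈ loopOps) :
    rComm A B = opComm (posPart A) (posPart B) - opComm (negPart A) (negPart B) := by
  have pA := loopOps_le_boundedOps (posPart_mem hA)
  have pB := loopOps_le_boundedOps (posPart_mem hB)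
  have nA := loopOps_le_boundedOps (negPart_mem hA)
  have nB := loopOps_le_boundedOps (negPart_mem hB)
  have h (X Y Z W : Op) (hX : X ∈ boundedOps) (hY : Y ∈ boundedOps) (hZ : Z ∈ boundedOps)
      (hW : W ∈ boundedOps) : opComm ((1 / 2 : ℂ) • (X - Y)) (Z + W) +
        opComm (X + Y) ((1 / 2 : ℂ) • (Z - W)) = opComm X Z - opComm Y W := by
    rw [smul_opComm, opComm_smul, ← smul_add, sub_eq_add_neg, sub_eq_add_neg,
      opComm_add (add_mem hX (neg_mem hY)) hZ hW, add_opComm hX (neg_mem hY) hZ,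
      add_opComm hX (neg_mem hY) hW, opComm_add (add_mem hX hY) hZ (neg_mem hW),
      add_opComm hX hY hZ, add_opComm hX hY (neg_mem hW)]
    simp only [← neg_one_smul ℂ (_ : Op), smul_opComm, opComm_smul]
    module
  have := h _ _ _ _ pA nA pB nB
  rwa [posPart_add_negPart A, posPart_add_negPart B] at this

theorem rComm_mem {A B : Op} (hA : A ∈ loopOps) (hB : B ∈ loopOps) : rComm A B ∈ loopOps := by
  rw [rComm_eq hA hB]
  exact sub_mem (opComm_mem_loopOps (posPart_mem hA) (posPart_mem hB))
    (opComm_mem_loopOps (negPart_mem hA) (negPart_mem hB))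

theorem posPart_rComm {A B : Op} (hA : A ∈ loopOps) (hB : B ∈ loopOps) :
    posPart (rComm A B) = opComm (posPart A) (posPart B) := by
  have h : posPart (-opComm (negPart A) (negPart B)) = 0 := posPart_eq_zero fun j hj => by
    simp [opComm, opMul_negPart_apply_of_nonneg _ _ hj]
  rw [rComm_eq hA hB, sub_eq_add_neg, posPart_add, h, add_zero]
  exact posPart_eq_self fun j hj => by simp [opComm, opMul_posPart_apply_of_neg _ _ hj]

theorem negPart_rComm {A B : Op} (hA : A ∈ loopOps) (hB : B ∈ loopOps) :
    negPart (rComm A B) = -opComm (negPart A) (negPart B) := by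
  have h := posPart_add_negPart (rComm A B)
  rw [posPart_rComm hA hB, rComm_eq hA hB, sub_eq_add_neg] at h
  rw [rComm_eq hA hB, sub_eq_add_neg]
  exact add_left_cancel h

theorem rComm_anticomm (A B : Op) : rComm A B = -rComm B A := by
  rw [rComm, rComm, opComm_anticomm (rMat A), opComm_anticomm A]; abel

/-- The reversed sign on the negative part occurs twice in a double bracket and disappears, leaving
the ordinary Jacobi identity in each part. -/
theorem rComm_jacobi {A B C : Op} (hA : A ∈ loopOps) (hB : B ∈ loopOps) (hC : C ∈ loopOps) :
    rComm A (rComm B C) + rComm B (rComm C A) + rComm C (rComm A B) = 0 := by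
  have e {A B C : Op} (hA : A ∈ loopOps) (hB : B ∈ loopOps) (hC : C ∈ loopOps) :
      rComm A (rComm B C) = opComm (posPart A) (opComm (posPart B) (posPart C)) +
        opComm (negPart A) (opComm (negPart B) (negPart C)) := by
    rw [rComm_eq hA (rComm_mem hB hC), posPart_rComm hB hC, negPart_rComm hB hC,
      ← neg_one_smul ℂ, opComm_smul, neg_one_smul, sub_neg_eq_add]
  have b {A : Op} (hA : A ∈ loopOps) := loopOps_le_boundedOps hA
  have h1 := opComm_jacobi (b (posPart_mem hA)) (b (posPart_mem hB)) (b (posPart_mem hC))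
  have h2 := opComm_jacobi (b (negPart_mem hA)) (b (negPart_mem hB)) (b (negPart_mem hC))
  -- The right side is split as 0 + 0, one zero for each of the two Jacobi sums.
  rw [e hA hB hC, e hB hC hA, e hC hA hB, ← add_zero (0 : Op)]
  nth_rw 1 [← h1]
  rw [← h2]
  abel

theorem rOmega_eq {A B : Op} (hA : A ∈ loopOps) (hB : B ∈ loopOps) :
    rOmega A B = omega (posPart A) (posPart B) - omega (negPart A) (negPart B) := by
  have pA := posPart_mem hA
  have nA := negPart_mem hA
  have pB := posPart_mem hB
  have nB := negPart_mem hB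
  have h {X Y Z W : Op} (hX : X ∈ loopOps) (hY : Y ∈ loopOps) (hZ : Z ∈ loopOps)
      (hW : W ∈ loopOps) : omega ((1 / 2 : ℂ) • (X - Y)) (Z + W) +
        omega (X + Y) ((1 / 2 : ℂ) • (Z - W)) = omega X Z - omega Y W := by
    have hnY := neg_mem hY
    have hnW := neg_mem hW
    rw [sub_eq_add_neg, sub_eq_add_neg, omega_smul_left, omega_smul_right _ _ (add_mem hZ hnW),
      omega_add_left hX hnY (add_mem hZ hW), omega_add_left hX hY (add_mem hZ hnW),
      omega_add_right hX hZ hW, omega_add_right hnY hZ hW, omega_add_right hX hZ hnW,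
      omega_add_right hY hZ hnW, omega_neg_left, omega_neg_left, omega_neg_right _ hW,
      omega_neg_right _ hW]
    ring
  have := h pA nA pB nB
  rwa [posPart_add_negPart A, posPart_add_negPart B] at this

theorem rOmega_skew {A B : Op} (hA : A ∈ loopOps) (hB : B ∈ loopOps) :
    rOmega A B = -rOmega B A := by
  rw [rOmega_eq hA hB, rOmega_eq hB hA, omega_skew (posPart_mem hA) (posPart_mem hB),
    omega_skew (negPart_mem hA) (negPart_mem hB)]
  ring

theorem rOmega_cocycle {A B C : Op} (hA : A ∈ loopOps) (hB : B ∈ loopOps) (hC : C ∈ loopOps) :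
    rOmega A (rComm B C) + rOmega B (rComm C A) + rOmega C (rComm A B) = 0 := by
  have e {A B C : Op} (hA : A ∈ loopOps) (hB : B ∈ loopOps) (hC : C ∈ loopOps) :
      rOmega A (rComm B C) = omega (posPart A) (opComm (posPart B) (posPart C)) +
        omega (negPart A) (opComm (negPart B) (negPart C)) := by
    rw [rOmega_eq hA (rComm_mem hB hC), posPart_rComm hB hC, negPart_rComm hB hC,
      omega_neg_right _ (opComm_mem_loopOps (negPart_mem hB) (negPart_mem hC)), sub_neg_eq_add]
  rw [e hA hB hC, e hB hC hA, e hC hA hB]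
  linear_combination omega_cocycle (posPart_mem hA) (posPart_mem hB) (posPart_mem hC) +
    omega_cocycle (negPart_mem hA) (negPart_mem hB) (negPart_mem hC)

/-- The trace pairs degree i with degree -i only, so the dual of the projection to degrees < 0 is
the projection to degrees > 0. This is the origin of the subscript > 0 in Θ. -/
theorem form_strictPart (A B : Op) : form A (strictPart B) = form (negPart A) B := by
  refine congrArg integ (finsum_congr fun i => ?_)
  by_cases h : i < 0
  · simp [strictPart, negPart, h]
  · simp [strictPart, negPart, h]

/-- The field `[l - c∂/∂y, r₊] - [l - c∂/∂y, r]_{>0}`. -/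
noncomputable def lieField (l : Op) (c : ℂ) (r : Op) : Op :=
  laxComm l c (posPart r) - strictPart (laxComm l c r)

theorem lieField_mem {l : Op} (hl : l ∈ dualOps) (c : ℂ) {r : Op} (hr : r ∈ loopOps) :
    lieField l c r ∈ dualOps :=
  sub_mem (laxComm_mem_dualOps hl c (posPart_mem hr)) (strictPart_mem (laxComm_mem_dualOps hl c hr))

theorem laxComm_add_left {l l' : Op} (hl : l ∈ boundedOps) (hl' : l' ∈ boundedOps) (c c' : ℂ)
    {r : Op} (hr : r ∈ boundedOps) :
    laxComm (l + l') (c + c') r = laxComm l c r + laxComm l' c' r := by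
  rw [laxComm, add_opComm hl hl' hr, add_smul, laxComm, laxComm]; abel

theorem laxComm_add_right {l : Op} (hl : l ∈ dualOps) (c : ℂ) {r r' : Op} (hr : r ∈ loopOps)
    (hr' : r' ∈ loopOps) : laxComm l c (r + r') = laxComm l c r + laxComm l c r' := by
  rw [laxComm, opComm_add (dualOps_le_boundedOps hl) (loopOps_le_boundedOps hr)
    (loopOps_le_boundedOps hr'), dyOp_add hr hr', smul_add, laxComm, laxComm]; abel

theorem laxComm_smul_right (l : Op) (c t : ℂ) {r : Op} (hr : r ∈ loopOps) :
    laxComm l c (t • r) = t • laxComm l c r := by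
  rw [laxComm, opComm_smul, dyOp_smul t hr, laxComm, smul_sub, smul_comm c t]

/-- Linearity holds in the pair (l, c) jointly; when l is split, c is assigned to one summand and
the others get 0. -/
theorem lieField_add_left {l l' : Op} (hl : l ∈ dualOps) (hl' : l' ∈ dualOps) (c c' : ℂ)
    {r : Op} (hr : r ∈ loopOps) :
    lieField (l + l') (c + c') r = lieField l c r + lieField l' c' r := by
  have bl := dualOps_le_boundedOps hl
  have bl' := dualOps_le_boundedOps hl'
  rw [lieField, laxComm_add_left bl bl' c c' (loopOps_le_boundedOps (posPart_mem hr)),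
    laxComm_add_left bl bl' c c' (loopOps_le_boundedOps hr), strictPart_add, lieField, lieField]
  abel

theorem lieField_add_smul_right {l : Op} (hl : l ∈ dualOps) (c t : ℂ) {r r' : Op}
    (hr : r ∈ loopOps) (hr' : r' ∈ loopOps) :
    lieField l c (r + t • r') = lieField l c r + t • lieField l c r' := by
  rw [lieField, posPart_add, posPart_smul, laxComm_add_right hl c (posPart_mem hr)
    (Submodule.smul_mem _ t (posPart_mem hr')), laxComm_smul_right l c t (posPart_mem hr'),
    laxComm_add_right hl c hr (Submodule.smul_mem _ t hr'), laxComm_smul_right l c t hr',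
    strictPart_add, strictPart_smul, lieField, lieField, smul_sub]
  abel

theorem lieField_zero (r : Op) : lieField 0 0 r = 0 := by
  have h (A : Op) : laxComm 0 0 A = 0 := by
    simpa [laxComm] using smul_opComm 0 0 A
  rw [lieField, h, h, sub_eq_zero]
  simpa using (strictPart_smul 0 0).symm

theorem lieField_sum {ι : Type*} (s : Finset ι) (l : ι → Op) (hl : ∀ i, l i ∈ dualOps)
    {r : Op} (hr : r ∈ loopOps) :
    lieField (∑ i ∈ s, l i) 0 r = ∑ i ∈ s, lieField (l i) 0 r := by
  classical
  induction s using Finset.induction_on with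
  | empty => simp [lieField_zero]
  | insert i s hi ih =>
    rw [Finset.sum_insert hi, Finset.sum_insert hi, ← ih,
      ← lieField_add_left (hl i) (sum_mem fun k _ => hl k) 0 0 hr, add_zero]

theorem form_laxComm {A B l : Op} (c : ℂ) (hA : A ∈ loopOps) (hB : B ∈ loopOps)
    (hl : l ∈ dualOps) :
    form A (laxComm l c B) = form (opComm B A) l - c * omega A B := by
  rw [laxComm, form_sub_right hA (opComm_mem_dualOps hl hB) (Submodule.smul_mem _ c
    (loopOps_le_dualOps (dyOp_mem_loopOps hB))), form_opComm hA hB hl, form_smul_right, omega]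

/-- Invariance moves l out of the commutators: the first term of the field pairs a₊ with b, the
second pairs a with b₋. The common mixed part (a₊, b₋) cancels and the ℛ-deformed bracket and
cocycle remain. -/
theorem form_lieField {a b l : Op} (c : ℂ) (ha : a ∈ loopOps) (hb : b ∈ loopOps)
    (hl : l ∈ dualOps) :
    form b (lieField l c a) = form (rComm a b) l + c * rOmega a b := by
  have pa := posPart_mem ha
  have na := negPart_mem ha
  have pb := posPart_mem hb
  have nb := negPart_mem hb
  rw [lieField, form_sub_right hb (laxComm_mem_dualOps hl c pa)
    (strictPart_mem (laxComm_mem_dualOps hl c ha)), form_strictPart, form_laxComm c hb pa hl,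
    form_laxComm c nb ha hl, rComm_eq ha hb, rOmega_eq ha hb,
    form_sub_left (opComm_mem_loopOps pa pb) (opComm_mem_loopOps na nb) hl]
  have h1 : form (opComm (posPart a) b) l =
      form (opComm (posPart a) (posPart b)) l + form (opComm (posPart a) (negPart b)) l := by
    rw [← form_add_left (opComm_mem_loopOps pa pb) (opComm_mem_loopOps pa nb) hl,
      ← opComm_add (loopOps_le_boundedOps pa) (loopOps_le_boundedOps pb)
        (loopOps_le_boundedOps nb), posPart_add_negPart b]
  have h2 : form (opComm a (negPart b)) l =
      form (opComm (posPart a) (negPart b)) l + form (opComm (negPart a) (negPart b)) l := by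
    rw [← form_add_left (opComm_mem_loopOps pa nb) (opComm_mem_loopOps na nb) hl,
      ← add_opComm (loopOps_le_boundedOps pa) (loopOps_le_boundedOps na)
        (loopOps_le_boundedOps nb), posPart_add_negPart a]
  have h3 : omega b (posPart a) = omega (posPart b) (posPart a) + omega (negPart b) (posPart a) := by
    rw [← omega_add_left pb nb pa, posPart_add_negPart b]
  have h4 : omega (negPart b) a = omega (negPart b) (posPart a) + omega (negPart b) (negPart a) := by
    rw [← omega_add_right nb pa na, posPart_add_negPart a]
  rw [h1, h2, h3, h4, omega_skew pb pa, omega_skew nb na]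
  ring

/-- The form separates the points of the loop algebra. -/
theorem eq_zero_of_form {A : Op} (hA : A ∈ loopOps) (h : ∀ B ∈ loopOps, form A B = 0) : A = 0 := by
  funext i
  refine eq_zero_of_integ_mul_schwartz (coef_mem_smoothCoef hA i) fun t ht => ?_
  -- This is ℰ^{-i}t with its coefficient moved to the left, chosen so that the degree-0 coefficient
  -- of AB is A i * t.
  let B : Op := fun j => if j = -i then shift j t else 0
  have hB : B ∈ loopOps := by
    refine mem_gradedOps.2 ⟨⟨-i, fun j hj => by simp [B, hj.ne']⟩, fun j => ?_⟩
    by_cases hj : j = -i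
    · simpa only [B, hj, if_true] using le_gradedCoef _ _ (shift_mem_schwartzCoef _ ht)
    · simp only [B, hj, if_false]
      exact zero_mem _
  have hf := h B hB
  rw [form] at hf
  convert hf using 1
  refine congrArg integ ?_
  rw [opMul, finsum_eq_single _ i fun j hj => ?_]
  · simp [B, shift_shift]
  · simp [B, hj]

/-! ## Operators without negative powers of the shift, acting on functions -/

/-- The elements of the loop algebra without terms of negative degree. -/
noncomputable def posOps : Submodule ℂ Op where
  carrier := {A | A ∈ loopOps ∧ ∀ j < 0, A j = 0}
  zero_mem' := ⟨zero_mem _, fun _ _ => rfl⟩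
  add_mem' hA hB := ⟨add_mem hA.1 hB.1, fun j hj => by
    rw [Pi.add_apply, hA.2 j hj, hB.2 j hj, add_zero]⟩
  smul_mem' t A hA := ⟨Submodule.smul_mem _ t hA.1, fun j hj => by
    rw [Pi.smul_apply, hA.2 j hj, smul_zero]⟩

theorem posPart_mem_posOps {A : Op} (hA : A ∈ loopOps) : posPart A ∈ posOps :=
  ⟨posPart_mem hA, fun _ hj => posPart_apply_of_neg A hj⟩

theorem finite_support_of_mem_posOps {A : Op} (hA : A ∈ posOps) : (Function.support A).Finite := by
  obtain ⟨m, hm⟩ := (mem_gradedOps.1 hA.1).1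
  refine (Set.finite_Icc 0 m).subset fun j hj => ?_
  by_contra hc
  rw [Set.mem_Icc, not_and_or, not_le, not_le] at hc
  exact hj (hc.elim (hA.2 j) (hm j))

theorem act_support {A : Op} (hA : A ∈ posOps) (f : Coef) :
    Function.HasFiniteSupport fun j => A j * shift j f :=
  (finite_support_of_mem_posOps hA).subset fun j hj h => hj (by simp [h])

theorem actT_support {A : Op} (hA : A ∈ posOps) (f : Coef) :
    Function.HasFiniteSupport fun j => shift (-j) (A j * f) :=
  (finite_support_of_mem_posOps hA).subset fun j hj h => hj (by simp [h])

theorem act_eq_sum {A : Op} (hA : A ∈ posOps) (f : Coef) :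
    act A f = ∑ j ∈ (finite_support_of_mem_posOps hA).toFinset, A j * shift j f :=
  finsum_eq_sum_of_support_subset _ fun j hj => by
    rw [Set.Finite.coe_toFinset]
    exact fun h => hj (by simp [h])

theorem actT_eq_sum {A : Op} (hA : A ∈ posOps) (f : Coef) :
    actT A f = ∑ j ∈ (finite_support_of_mem_posOps hA).toFinset, shift (-j) (A j * f) :=
  finsum_eq_sum_of_support_subset _ fun j hj => by
    rw [Set.Finite.coe_toFinset]
    exact fun h => hj (by simp [h])

theorem act_mem {A : Op} (hA : A ∈ posOps) {f : Coef} (hf : f ∈ Lp ℂ 2 mu) :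
    act A f ∈ Lp ℂ 2 mu := by
  rw [act_eq_sum hA]
  exact sum_mem fun j _ => mul_mem_Lp (p := ⊤) (coef_mem_Linfty hA.1 j) (shift_mem_Lp j hf)

theorem actT_mem {A : Op} (hA : A ∈ posOps) {f : Coef} (hf : f ∈ Lp ℂ 2 mu) :
    actT A f ∈ Lp ℂ 2 mu := by
  rw [actT_eq_sum hA]
  exact sum_mem fun j _ => shift_mem_Lp (-j) (mul_mem_Lp (p := ⊤) (coef_mem_Linfty hA.1 j) hf)

theorem add_act {A B : Op} (hA : A ∈ posOps) (hB : B ∈ posOps) (f : Coef) :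
    act (A + B) f = act A f + act B f := by
  simp only [act, Pi.add_apply, add_mul]
  exact finsum_add_distrib (act_support hA f) (act_support hB f)

theorem add_actT {A B : Op} (hA : A ∈ posOps) (hB : B ∈ posOps) (f : Coef) :
    actT (A + B) f = actT A f + actT B f := by
  simp only [actT, Pi.add_apply, add_mul, shift_add]
  exact finsum_add_distrib (actT_support hA f) (actT_support hB f)

theorem smul_act (t : ℂ) (A : Op) (f : Coef) : act (t • A) f = t • act A f := by
  simp only [act, Pi.smul_apply, smul_mul_assoc]
  exact (smul_finsum t _).symm

theorem smul_actT (t : ℂ) (A : Op) (f : Coef) : actT (t • A) f = t • actT A f := by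
  simp only [actT, Pi.smul_apply, smul_mul_assoc, shift_smul]
  exact (smul_finsum t _).symm

theorem act_add {A : Op} (hA : A ∈ posOps) (f g : Coef) : act A (f + g) = act A f + act A g := by
  simp only [act, shift_add, mul_add]
  exact finsum_add_distrib (act_support hA f) (act_support hA g)

theorem act_smul (t : ℂ) (A : Op) (f : Coef) : act A (t • f) = t • act A f := by
  simp only [act, shift_smul, mul_smul_comm]
  exact (smul_finsum t _).symm

theorem act_sub {A : Op} (hA : A ∈ posOps) (f g : Coef) : act A (f - g) = act A f - act A g := by
  rw [sub_eq_add_neg, act_add hA, ← neg_one_smul ℂ g, act_smul, neg_one_smul, sub_eq_add_neg]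

/-- The regrouping over pairs of degrees is that of `opMul_assoc`; finiteness now comes from both
factors having finitely many terms. -/
theorem act_opMul {A B : Op} (hA : A ∈ posOps) (hB : B ∈ posOps) (f : Coef) :
    act (opMul A B) f = act A (act B f) := by
  let G : ℤ × ℤ → Coef := fun x =>
    A x.1 * shift x.1 (B x.2) * shift (x.1 + x.2) f
  let e : ℤ × ℤ ≃ ℤ × ℤ :=
    ⟨fun x => (x.2, x.1 - x.2), fun x => (x.1 + x.2, x.1), fun x => by simp, fun x => by simp⟩
  have hG : G.HasFiniteSupport :=
    ((finite_support_of_mem_posOps hA).prod (finite_support_of_mem_posOps hB)).subset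
      fun x hx => ⟨fun h => hx (by simp [G, h]), fun h => hx (by simp [G, h])⟩
  have bA := loopOps_le_boundedOps hA.1
  have bB := loopOps_le_boundedOps hB.1
  calc act (opMul A B) f = ∑ᶠ i, ∑ᶠ j, G (e (i, j)) := by
        refine finsum_congr fun i => ?_
        rw [opMul, finsum_mul' _ _ (hasFiniteSupport_mul_shift bA bB i)]
        refine finsum_congr fun j => ?_
        simp [G, e]
    _ = ∑ᶠ x, G (e x) := (finsum_curry (fun x => G (e x)) (hG.preimage e.injective.injOn)).symm
    _ = ∑ᶠ x, G x := finsum_comp_equiv e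
    _ = ∑ᶠ i, ∑ᶠ j, G (i, j) := finsum_curry G hG
    _ = act A (act B f) := by
        refine finsum_congr fun i => ?_
        have hf := act_support hB f
        have hs : shift i (act B f) = ∑ᶠ j, shift i (B j * shift j f) :=
          AddMonoidHom.map_finsum (shiftHom i).toAddMonoidHom hf
        rw [hs, mul_finsum' _ _ (hf.subset fun j hj h => hj ?_)]
        · refine finsum_congr fun j => ?_
          simp [G, mul_assoc, shift_mul, shift_shift]
        · simp only at h
          simp [h]

theorem act_opComm {A B : Op} (hA : A ∈ loopOps) (hB : B ∈ loopOps) (f : Coef) :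
    act (opComm (posPart A) (posPart B)) f =
      act (posPart A) (act (posPart B) f) - act (posPart B) (act (posPart A) f) := by
  have h {A B : Op} (hA : A ∈ loopOps) (hB : B ∈ loopOps) :
      opMul (posPart A) (posPart B) ∈ posOps :=
    ⟨opMul_mem_loopOps (posPart_mem hA) (posPart_mem hB),
      fun j hj => opMul_posPart_apply_of_neg A B hj⟩
  rw [opComm, sub_eq_add_neg, ← neg_one_smul ℂ (opMul _ _),
    add_act (h hA hB) (Submodule.smul_mem _ _ (h hB hA)), smul_act, neg_one_smul,
    act_opMul (posPart_mem_posOps hA) (posPart_mem_posOps hB),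
    act_opMul (posPart_mem_posOps hB) (posPart_mem_posOps hA), sub_eq_add_neg]

/-! ## The pairing of functions -/

theorem pairW_comm (f g : Coef) : pairW f g = pairW g f := by
  rw [pairW_eq_integ, pairW_eq_integ, mul_comm f g]

theorem mul_mem_L1 {f g : Coef} (hf : f ∈ Lp ℂ 2 mu) (hg : g ∈ Lp ℂ 2 mu) :
    f * g ∈ Lp ℂ 1 mu := mul_mem_Lp (p := 2) (q := 2) hf hg

theorem pairW_add_left {f g h : Coef} (hf : f ∈ Lp ℂ 2 mu) (hg : g ∈ Lp ℂ 2 mu)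
    (hh : h ∈ Lp ℂ 2 mu) : pairW (f + g) h = pairW f h + pairW g h := by
  simp only [pairW_eq_integ, add_mul]
  exact integ_add (mul_mem_L1 hf hh) (mul_mem_L1 hg hh)

theorem pairW_smul_left (t : ℂ) (f g : Coef) : pairW (t • f) g = t * pairW f g := by
  rw [pairW_eq_integ, pairW_eq_integ, smul_mul_assoc, integ_smul]

theorem pairW_neg_left (f g : Coef) : pairW (-f) g = -pairW f g := by
  simpa using pairW_smul_left (-1) f g

theorem pairW_sub_left {f g h : Coef} (hf : f ∈ Lp ℂ 2 mu) (hg : g ∈ Lp ℂ 2 mu)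
    (hh : h ∈ Lp ℂ 2 mu) : pairW (f - g) h = pairW f h - pairW g h := by
  rw [sub_eq_add_neg, pairW_add_left hf (neg_mem hg) hh, pairW_neg_left, sub_eq_add_neg]

theorem pairW_add_right {f g h : Coef} (hf : f ∈ Lp ℂ 2 mu) (hg : g ∈ Lp ℂ 2 mu)
    (hh : h ∈ Lp ℂ 2 mu) : pairW f (g + h) = pairW f g + pairW f h := by
  rw [pairW_comm, pairW_add_left hg hh hf, pairW_comm g, pairW_comm h]

theorem pairW_smul_right (t : ℂ) (f g : Coef) : pairW f (t • g) = t * pairW f g := by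
  rw [pairW_comm, pairW_smul_left, pairW_comm]

theorem pairW_neg_right (f g : Coef) : pairW f (-g) = -pairW f g := by
  rw [pairW_comm, pairW_neg_left, pairW_comm]

theorem pairW_sub_right {f g h : Coef} (hf : f ∈ Lp ℂ 2 mu) (hg : g ∈ Lp ℂ 2 mu)
    (hh : h ∈ Lp ℂ 2 mu) : pairW f (g - h) = pairW f g - pairW f h := by
  rw [pairW_comm, pairW_sub_left hg hh hf, pairW_comm g, pairW_comm h]

@[simp] theorem pairW_zero_left (f : Coef) : pairW 0 f = 0 := by
  simpa using pairW_smul_left 0 0 f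

@[simp] theorem pairW_zero_right (f : Coef) : pairW f 0 = 0 := by
  rw [pairW_comm, pairW_zero_left]

/-- Each summand is moved across by shifting the integrand by -j. -/
theorem pairW_actT {A : Op} (hA : A ∈ posOps) {f g : Coef} (hf : f ∈ Lp ℂ 2 mu)
    (hg : g ∈ Lp ℂ 2 mu) : pairW (actT A f) g = pairW f (act A g) := by
  have hAf (j : ℤ) : A j * f ∈ Lp ℂ 2 mu := mul_mem_Lp (p := ⊤) (coef_mem_Linfty hA.1 j) hf
  have e (j : ℤ) : shift (-j) (A j * f * shift j g) = shift (-j) (A j * f) * g := by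
    rw [shift_mul, shift_shift, neg_add_cancel, shift_by_zero]
  rw [pairW_eq_integ, pairW_eq_integ, act_eq_sum hA, actT_eq_sum hA, Finset.sum_mul,
    Finset.mul_sum, integ_sum _ _ fun j _ => mul_mem_L1 (shift_mem_Lp (-j) (hAf j)) hg,
    integ_sum _ _ fun j _ => ?_]
  · refine Finset.sum_congr rfl fun j _ => ?_
    rw [← e, integ_shift]
    congr 1
    ring
  · have := mul_mem_L1 (hAf j) (shift_mem_Lp j hg)
    convert this using 1
    ring

/-! ## The operators `f ℰ (ℰ - 1)⁻¹ g` -/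

theorem dyad_mem {f g : Coef} (hf : f ∈ Lp ℂ 2 mu) (hg : g ∈ Lp ℂ 2 mu) : dyad f g ∈ dualOps := by
  refine mem_gradedOps.2 ⟨⟨0, fun j hj => if_neg (not_le.2 hj)⟩, fun j => ?_⟩
  unfold dyad
  split_ifs with h
  · exact le_gradedCoef _ _ (mul_mem_L1 hf (shift_mem_Lp j hg))
  · exact zero_mem _

theorem add_dyad (f g h : Coef) : dyad (f + g) h = dyad f h + dyad g h := by
  funext j; by_cases hj : j ≤ 0 <;> simp [dyad, hj, add_mul]

theorem dyad_add (f g h : Coef) : dyad f (g + h) = dyad f g + dyad f h := by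
  funext j; by_cases hj : j ≤ 0 <;> simp [dyad, hj, shift_add, mul_add]

theorem smul_dyad (t : ℂ) (f g : Coef) : dyad (t • f) g = t • dyad f g := by
  funext j; by_cases hj : j ≤ 0 <;> simp [dyad, hj, smul_mul_assoc]

theorem dyad_smul (t : ℂ) (f g : Coef) : dyad f (t • g) = t • dyad f g := by
  funext j; by_cases hj : j ≤ 0 <;> simp [dyad, hj, shift_smul, mul_smul_comm]

theorem neg_dyad (f g : Coef) : dyad (-f) g = -dyad f g := by
  simpa using smul_dyad (-1) f g

/-- Since `dyad f g` has degrees ≤ 0, only r₊ meets it in the trace. This identity determines the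
action terms of `backlundAdj`. -/
theorem form_dyad {r : Op} (hr : r ∈ loopOps) (f g : Coef) :
    form r (dyad f g) = pairW (act (posPart r) f) g := by
  rw [pairW_eq_integ]
  refine congrArg integ ?_
  rw [act, finsum_mul' _ _ (act_support (posPart_mem_posOps hr) f)]
  refine finsum_congr fun j => ?_
  by_cases hj : 0 ≤ j
  · simp [dyad, posPart, hj, shift_mul, shift_shift, mul_assoc]
  · simp [dyad, posPart, hj]

/-- For k ≤ 0 and j ≥ 0 the truncation condition k - j ≤ 0 is automatic, so A acts on f undisturbed;
in positive degrees the truncation would interfere. -/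
theorem opMul_dyad {A : Op} (hA : A ∈ posOps) (f g : Coef) {k : ℤ} (hk : k ≤ 0) :
    opMul A (dyad f g) k = dyad (act A f) g k := by
  rw [dyad, if_pos hk, act, finsum_mul' _ _ (act_support hA f)]
  refine finsum_congr fun j => ?_
  by_cases hj : j < 0
  · simp [hA.2 j hj]
  · simp [dyad, show k ≤ j by omega, shift_mul, shift_shift, mul_assoc]

theorem dyad_opMul {A : Op} (hA : A ∈ posOps) (f g : Coef) {k : ℤ} (hk : k ≤ 0) :
    opMul (dyad f g) A k = dyad f (actT A g) k := by
  have hs := actT_support hA g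
  have e : shift k (actT A g) = ∑ᶠ j, shift k (shift (-j) (A j * g)) :=
    AddMonoidHom.map_finsum (shiftHom k).toAddMonoidHom hs
  -- After the substitution j = k - i, the terms with i > 0 vanish on both sides: on one by
  -- truncation, on the other because k - i < 0 and A has no negative degrees.
  rw [dyad, if_pos hk, e, mul_finsum' _ _ (hs.subset fun j hj h => hj ?_),
    ← finsum_comp_equiv (Equiv.subLeft k)]
  · refine finsum_congr fun i => ?_
    rw [Equiv.subLeft_apply]
    by_cases hi : i ≤ 0
    · simp only [dyad, hi, if_true, shift_shift, shift_mul]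
      rw [show k + -(k - i) = i by ring]
      ring
    · simp [dyad, hi, hA.2 (k - i) (by omega)]
  · simp only at h
    simp [h]

theorem opComm_dyad_negPart_apply (f g : Coef) (r : Op) {k : ℤ} (hk : 0 < k) :
    opComm (dyad f g) (negPart r) k = 0 := by
  have h1 : opMul (dyad f g) (negPart r) k = 0 := finsum_eq_zero_of_forall_eq_zero fun i => by
    by_cases hi : i ≤ 0
    · rw [negPart_apply_of_nonneg r (by omega), shift_zero, mul_zero]
    · simp [dyad, hi]
  have h2 : opMul (negPart r) (dyad f g) k = 0 := finsum_eq_zero_of_forall_eq_zero fun i => by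
    by_cases hi : i < 0
    · simp [dyad, show ¬k ≤ i by omega]
    · rw [negPart_apply_of_nonneg r (by omega), zero_mul]
  rw [opComm, Pi.sub_apply, h1, h2, sub_zero]

/-- In degrees ≤ 0 only the commutator with r₊ contributes, and r₊ passes onto g or f. In degrees >
0 the negative part of r contributes nothing, so the two terms of the field cancel. -/
theorem lieField_dyad {f g : Coef} (hf : f ∈ Lp ℂ 2 mu) (hg : g ∈ Lp ℂ 2 mu) {r : Op}
    (hr : r ∈ loopOps) :
    lieField (dyad f g) 0 r = dyad f (actT (posPart r) g) - dyad (act (posPart r) f) g := by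
  have hp := posPart_mem_posOps hr
  have hc : opComm (dyad f g) r =
      opComm (dyad f g) (posPart r) + opComm (dyad f g) (negPart r) := by
    rw [← opComm_add (dualOps_le_boundedOps (dyad_mem hf hg)) (loopOps_le_boundedOps hp.1)
      (loopOps_le_boundedOps (negPart_mem hr)), posPart_add_negPart r]
  funext k
  simp only [lieField, laxComm, zero_smul, sub_zero, Pi.sub_apply]
  by_cases hk : k ≤ 0
  · rw [strictPart, if_neg (not_lt.2 hk), opComm, Pi.sub_apply, dyad_opMul hp f g hk,
      opMul_dyad hp f g hk, sub_zero]
  · rw [strictPart, if_pos (not_le.1 hk), hc, Pi.add_apply,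
      opComm_dyad_negPart_apply f g r (not_le.1 hk)]
    simp [dyad, hk]

variable {N : ℕ}

/-! ## The extended phase space -/

theorem mem_phase {x : Vec N} : x ∈ phase N ↔ x.l ∈ loopOps ∧ IsL2 x :=
  and_congr mem_loopOps.symm Iff.rfl

theorem mem_phaseExt {x : Vec N} : x ∈ phaseExt N ↔ x.l ∈ dualOps ∧ IsL2 x :=
  and_congr mem_dualOps.symm Iff.rfl

theorem add_smul_mem_phaseExt {x h : Vec N} (t : ℂ) (hx : x ∈ phaseExt N) (hh : h ∈ phaseExt N) :
    x + t • h ∈ phaseExt N := by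
  rw [mem_phaseExt] at *
  exact ⟨add_mem hx.1 (Submodule.smul_mem _ t hh.1), fun i =>
    ⟨add_mem (hx.2 i).1 (Lp.const_smul_mem_Lp t ⟨_, (hh.2 i).1⟩),
      add_mem (hx.2 i).2 (Lp.const_smul_mem_Lp t ⟨_, (hh.2 i).2⟩)⟩⟩

theorem pair_add_smul {a x h : Vec N} (t : ℂ) (ha : a ∈ phase N) (hx : x ∈ phaseExt N)
    (hh : h ∈ phaseExt N) : pair a (x + t • h) = pair a x + t * pair a h := by
  rw [mem_phase] at ha
  rw [mem_phaseExt] at hx hh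
  have smul_mem {f : Coef} (hf : f ∈ Lp ℂ 2 mu) : t • f ∈ Lp ℂ 2 mu :=
    Lp.const_smul_mem_Lp t ⟨_, hf⟩
  have e (i : Fin N) : pairW (a.f i) (x.f i + t • h.f i) + pairW (a.fs i) (x.fs i + t • h.fs i) =
      (pairW (a.f i) (x.f i) + pairW (a.fs i) (x.fs i)) +
        t * (pairW (a.f i) (h.f i) + pairW (a.fs i) (h.fs i)) := by
    rw [pairW_add_right (ha.2 i).1 (hx.2 i).1 (smul_mem (hh.2 i).1),
      pairW_add_right (ha.2 i).2 (hx.2 i).2 (smul_mem (hh.2 i).2), pairW_smul_right,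
      pairW_smul_right]
    ring
  change form a.l (x.l + t • h.l) + a.c * (x.c + t * h.c) + ∑ i, (pairW (a.f i) (x.f i + t • h.f i)
    + pairW (a.fs i) (x.fs i + t • h.fs i)) = _
  simp only [e]
  rw [form_add_right ha.1 hx.1 (Submodule.smul_mem _ t hh.1), form_smul_right,
    Finset.sum_add_distrib, ← Finset.mul_sum, pair, pair]
  ring

/-- The Lie bracket of covectors: the `ℛ`-deformed central extension acting on `W ⊕ W` through
the parts of nonnegative degree. -/
noncomputable def bracket (a b : Vec N) : Vec N where
  l := rComm a.l b.l
  c := rOmega a.l b.l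
  f := fun i => actT (posPart b.l) (a.f i) - actT (posPart a.l) (b.f i)
  fs := fun i => act (posPart a.l) (b.fs i) - act (posPart b.l) (a.fs i)

/-- The canonical symplectic form. -/
noncomputable def canon (a b : Vec N) : ℂ :=
  ∑ i, (pairW (b.fs i) (a.f i) - pairW (b.f i) (a.fs i))

/-! ### The brackets defined by `thetaTilde` and `theta` -/

theorem bracket_mem_phase {a b : Vec N} (ha : a ∈ phase N) (hb : b ∈ phase N) :
    bracket a b ∈ phase N := by
  rw [mem_phase] at *
  have pa := posPart_mem_posOps ha.1
  have pb := posPart_mem_posOps hb.1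
  exact ⟨rComm_mem ha.1 hb.1, fun i =>
    ⟨sub_mem (actT_mem pb (ha.2 i).1) (actT_mem pa (hb.2 i).1),
      sub_mem (act_mem pa (hb.2 i).2) (act_mem pb (ha.2 i).2)⟩⟩

theorem pair_thetaTilde {x a b : Vec N} (hx : x ∈ phaseExt N) (ha : a ∈ phase N)
    (hb : b ∈ phase N) : pair b (thetaTilde x a) =
      form x.l (rComm a.l b.l) + x.c * rOmega a.l b.l + canon a b := by
  rw [mem_phase] at ha hb
  rw [mem_phaseExt] at hx
  change form b.l (lieField x.l x.c a.l) + b.c * 0 +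
    ∑ i, (pairW (b.f i) (-a.fs i) + pairW (b.fs i) (a.f i)) = _
  rw [form_lieField x.c ha.1 hb.1 hx.1, form_comm (rComm_mem ha.1 hb.1) hx.1, canon, mul_zero,
    add_zero]
  congr 1
  refine Finset.sum_congr rfl fun i _ => ?_
  rw [pairW_neg_right]
  ring

theorem theta_mem_phaseExt {x a : Vec N} (hx : x ∈ phaseExt N) (ha : a ∈ phase N) :
    theta x a ∈ phaseExt N := by
  rw [mem_phase] at ha
  rw [mem_phaseExt] at *
  have pa := posPart_mem_posOps ha.1
  refine ⟨add_mem (lieField_mem hx.1 x.c ha.1) (sum_mem fun i _ =>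
    sub_mem (dyad_mem (hx.2 i).1 (ha.2 i).1) (dyad_mem (ha.2 i).2 (hx.2 i).2)), fun i =>
    ⟨sub_mem (neg_mem (ha.2 i).2) (act_mem pa (hx.2 i).1),
      add_mem (ha.2 i).1 (actT_mem pa (hx.2 i).2)⟩⟩

/-- `Θ` is an affine Lie–Poisson structure. -/
theorem pair_theta {x a b : Vec N} (hx : x ∈ phaseExt N) (ha : a ∈ phase N) (hb : b ∈ phase N) :
    pair b (theta x a) = pair (bracket a b) x + canon a b := by
  rw [mem_phase] at ha hb
  rw [mem_phaseExt] at hx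
  have pa := posPart_mem_posOps ha.1
  have pb := posPart_mem_posOps hb.1
  have hd (i : Fin N) := dyad_mem (hx.2 i).1 (ha.2 i).1
  have hd' (i : Fin N) := dyad_mem (ha.2 i).2 (hx.2 i).2
  -- Through `form_dyad` the dyads of Θ supply the terms of the bracket in which b₊ acts; the f and
  -- f^* components supply those with a₊ and the canonical form.
  have key (i : Fin N) : form b.l (dyad (x.f i) (a.f i) - dyad (a.fs i) (x.fs i)) +
      (pairW (b.f i) (-a.fs i - act (posPart a.l) (x.f i)) +
        pairW (b.fs i) (a.f i + actT (posPart a.l) (x.fs i))) =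
      (pairW ((bracket a b).f i) (x.f i) + pairW ((bracket a b).fs i) (x.fs i)) +
        (pairW (b.fs i) (a.f i) - pairW (b.f i) (a.fs i)) := by
    obtain ⟨xf, xs⟩ := hx.2 i
    obtain ⟨af, as⟩ := ha.2 i
    obtain ⟨bf, bs⟩ := hb.2 i
    rw [form_sub_right hb.1 (hd i) (hd' i), form_dyad hb.1, form_dyad hb.1,
      pairW_sub_right bf (neg_mem as) (act_mem pa xf), pairW_neg_right,
      pairW_add_right bs af (actT_mem pa xs), bracket,
      pairW_sub_left (actT_mem pb af) (actT_mem pa bf) xf,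
      pairW_sub_left (act_mem pa bs) (act_mem pb as) xs,
      pairW_actT pb af xf, pairW_actT pa bf xf, pairW_comm (b.fs i) (actT _ _),
      pairW_actT pa xs bs, pairW_comm (x.fs i), pairW_comm (a.f i) (act _ _)]
    ring
  have hsum := Finset.sum_congr (rfl : (Finset.univ : Finset (Fin N)) = _) fun i _ => key i
  rw [Finset.sum_add_distrib, Finset.sum_add_distrib (g := fun i =>
    pairW (b.fs i) (a.f i) - pairW (b.f i) (a.fs i))] at hsum
  change form b.l (lieField x.l x.c a.l +
    ∑ i, (dyad (x.f i) (a.f i) - dyad (a.fs i) (x.fs i))) + b.c * 0 + _ = _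
  rw [form_add_right hb.1 (lieField_mem hx.1 x.c ha.1)
    (sum_mem fun i _ => sub_mem (hd i) (hd' i)), form_sum_right _ hb.1 _
    (fun i => sub_mem (hd i) (hd' i)), form_lieField x.c ha.1 hb.1 hx.1, pair, canon]
  change _ = form (rComm a.l b.l) x.l + rOmega a.l b.l * x.c + _ + _
  simp only [theta]
  linear_combination hsum

/-! ### Skew-symmetry and the Jacobi identity of the affine structure -/

theorem pair_bracket_skew (x : Vec N) {a b : Vec N} (ha : a ∈ phase N) (hb : b ∈ phase N) :
    pair (bracket a b) x = -pair (bracket b a) x := by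
  rw [mem_phase] at ha hb
  have e (i : Fin N) : pairW ((bracket a b).f i) (x.f i) + pairW ((bracket a b).fs i) (x.fs i) =
      -(pairW ((bracket b a).f i) (x.f i) + pairW ((bracket b a).fs i) (x.fs i)) := by
    have h1 : (bracket a b).f i = -(bracket b a).f i := by simp [bracket]
    have h2 : (bracket a b).fs i = -(bracket b a).fs i := by simp [bracket]
    rw [h1, h2, pairW_neg_left, pairW_neg_left]
    ring
  rw [pair, Finset.sum_congr rfl fun i _ => e i, Finset.sum_neg_distrib, pair]
  change form (rComm a.l b.l) x.l + rOmega a.l b.l * x.c + _ =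
    -(form (rComm b.l a.l) x.l + rOmega b.l a.l * x.c + _)
  rw [rComm_anticomm, form_neg_left, rOmega_skew ha.1 hb.1]
  ring

theorem canon_skew (a b : Vec N) : canon a b = -canon b a := by
  rw [canon, canon, ← Finset.sum_neg_distrib]
  refine Finset.sum_congr rfl fun i _ => ?_
  rw [pairW_comm (b.fs i), pairW_comm (b.f i)]
  ring

/-- The contribution of the `i`-th eigenfunctions to `{b, {d, a}}`. -/
theorem pairW_bracket_bracket {x a b d : Vec N} (hx : x ∈ phaseExt N) (ha : a ∈ phase N)
    (hb : b ∈ phase N) (hd : d ∈ phase N) (i : Fin N) :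
    (pairW ((bracket b (bracket d a)).f i) (x.f i) +
      pairW ((bracket b (bracket d a)).fs i) (x.fs i)) +
      (pairW ((bracket d a).fs i) (b.f i) - pairW ((bracket d a).f i) (b.fs i)) =
    pairW (act (posPart d.l) (act (posPart a.l) (x.f i))) (b.f i)
      - pairW (act (posPart a.l) (act (posPart d.l) (x.f i))) (b.f i)
      - pairW (act (posPart a.l) (act (posPart b.l) (x.f i))) (d.f i)
      + pairW (act (posPart d.l) (act (posPart b.l) (x.f i))) (a.f i)
      + pairW (act (posPart b.l) (act (posPart d.l) (a.fs i))) (x.fs i)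
      - pairW (act (posPart b.l) (act (posPart a.l) (d.fs i))) (x.fs i)
      - pairW (act (posPart d.l) (act (posPart a.l) (b.fs i))) (x.fs i)
      + pairW (act (posPart a.l) (act (posPart d.l) (b.fs i))) (x.fs i)
      + pairW (act (posPart d.l) (a.fs i)) (b.f i) - pairW (act (posPart a.l) (d.fs i)) (b.f i)
      - pairW (act (posPart a.l) (b.fs i)) (d.f i)
      + pairW (act (posPart d.l) (b.fs i)) (a.f i) := by
  have he := bracket_mem_phase hd ha
  rw [mem_phase] at ha hb hd he
  rw [mem_phaseExt] at hx
  obtain ⟨xf, xs⟩ := hx.2 i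
  obtain ⟨af, as⟩ := ha.2 i
  obtain ⟨bf, bs⟩ := hb.2 i
  obtain ⟨df, ds⟩ := hd.2 i
  obtain ⟨ef, es⟩ := he.2 i
  have pa := posPart_mem_posOps ha.1
  have pb := posPart_mem_posOps hb.1
  have pd := posPart_mem_posOps hd.1
  have pe := posPart_mem_posOps he.1
  have hE : posPart (bracket d a).l = opComm (posPart d.l) (posPart a.l) :=
    posPart_rComm hd.1 ha.1
  have ef_pair {g : Coef} (hg : g ∈ Lp ℂ 2 mu) : pairW ((bracket d a).f i) g =
      pairW (act (posPart a.l) g) (d.f i) - pairW (act (posPart d.l) g) (a.f i) := by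
    simp only [bracket]
    rw [pairW_sub_left (actT_mem pa df) (actT_mem pd af) hg, pairW_actT pa df hg,
      pairW_actT pd af hg, pairW_comm, pairW_comm (a.f i)]
  have act_e {g : Coef} : act (posPart (bracket d a).l) g =
      act (posPart d.l) (act (posPart a.l) g) - act (posPart a.l) (act (posPart d.l) g) := by
    rw [hE, act_opComm hd.1 ha.1]
  have h1 : pairW ((bracket b (bracket d a)).f i) (x.f i) =
      pairW (act (posPart (bracket d a).l) (x.f i)) (b.f i) -
        pairW ((bracket d a).f i) (act (posPart b.l) (x.f i)) := by
    rw [show (bracket b (bracket d a)).f i = actT (posPart (bracket d a).l) (b.f i) -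
      actT (posPart b.l) ((bracket d a).f i) from rfl,
      pairW_sub_left (actT_mem pe bf) (actT_mem pb ef) xf, pairW_actT pe bf xf,
      pairW_actT pb ef xf, pairW_comm]
  have h2 : (bracket b (bracket d a)).fs i = act (posPart b.l) ((bracket d a).fs i) -
      act (posPart (bracket d a).l) (b.fs i) := rfl
  have h3 : (bracket d a).fs i = act (posPart d.l) (a.fs i) - act (posPart a.l) (d.fs i) := rfl
  -- All transposes are removed and every operator is made to act in the left slot, so that cyclic
  -- permutations of a, b, d produce literally matching terms.
  rw [h1, h2, ef_pair (act_mem pb xf), ef_pair bs, act_e, act_e, h3, act_sub pb]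
  have m2 {A B : Op} (hA : A ∈ posOps) (hB : B ∈ posOps) {g : Coef} (hg : g ∈ Lp ℂ 2 mu) :
    act A (act B g) ∈ Lp ℂ 2 mu := act_mem hA (act_mem hB hg)
  rw [pairW_sub_left (m2 pd pa xf) (m2 pa pd xf) bf,
    pairW_sub_left (sub_mem (m2 pb pd as) (m2 pb pa ds)) (sub_mem (m2 pd pa bs) (m2 pa pd bs)) xs,
    pairW_sub_left (m2 pb pd as) (m2 pb pa ds) xs, pairW_sub_left (m2 pd pa bs) (m2 pa pd bs) xs,
    pairW_sub_left (act_mem pd as) (act_mem pa ds) bf]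
  ring

theorem bracket_jacobi {x a b d : Vec N} (hx : x ∈ phaseExt N) (ha : a ∈ phase N)
    (hb : b ∈ phase N) (hd : d ∈ phase N) :
    (pair (bracket b (bracket d a)) x + canon b (bracket d a)) +
      (pair (bracket d (bracket a b)) x + canon d (bracket a b)) +
      (pair (bracket a (bracket b d)) x + canon a (bracket b d)) = 0 := by
  have la := (mem_phase.1 ha).1
  have lb := (mem_phase.1 hb).1
  have ld := (mem_phase.1 hd).1
  have lx := (mem_phaseExt.1 hx).1
  have e (a b d : Vec N) : pair (bracket b (bracket d a)) x + canon b (bracket d a) =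
      form (rComm b.l (rComm d.l a.l)) x.l + rOmega b.l (rComm d.l a.l) * x.c +
      ∑ i, ((pairW ((bracket b (bracket d a)).f i) (x.f i) +
        pairW ((bracket b (bracket d a)).fs i) (x.fs i)) +
        (pairW ((bracket d a).fs i) (b.f i) - pairW ((bracket d a).f i) (b.fs i))) := by
    rw [Finset.sum_add_distrib, ← add_assoc]
    rfl
  have hs : ∑ i : Fin N, _ + ∑ i : Fin N, _ + ∑ i : Fin N, _ = _ :=
    congrArg₂ (· + ·) (congrArg₂ (· + ·)
    (Finset.sum_congr rfl fun i _ => pairW_bracket_bracket hx ha hb hd i)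
    (Finset.sum_congr rfl fun i _ => pairW_bracket_bracket hx hb hd ha i))
    (Finset.sum_congr rfl fun i _ => pairW_bracket_bracket hx hd ha hb i)
  rw [e, e, e]
  -- The three expansions cancel term by term for each i.
  have hz := hs.trans (b := _) (c := 0) (by
    simp only [← Finset.sum_add_distrib]
    exact Finset.sum_eq_zero fun i _ => by ring)
  have hj : form (rComm b.l (rComm d.l a.l)) x.l + form (rComm d.l (rComm a.l b.l)) x.l +
      form (rComm a.l (rComm b.l d.l)) x.l = 0 := by
    have m1 := rComm_mem lb (rComm_mem ld la)
    have m2 := rComm_mem ld (rComm_mem la lb)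
    have m3 := rComm_mem la (rComm_mem lb ld)
    rw [← form_add_left m1 m2 lx, ← form_add_left (add_mem m1 m2) m3 lx, rComm_jacobi lb ld la,
      form_zero_left]
  linear_combination hz + hj + x.c * rOmega_cocycle lb ld la

theorem theta_add_smul {x a b : Vec N} (hx : x ∈ phaseExt N) (ha : a ∈ phase N) (hb : b ∈ phase N)
    (s : ℂ) : theta x (a + s • b) = theta x a + s • theta x b := by
  rw [mem_phase] at ha hb
  rw [mem_phaseExt] at hx
  have pa := posPart_mem_posOps ha.1
  have pb := Submodule.smul_mem _ s (posPart_mem_posOps hb.1)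
  have hp : posPart (a.l + s • b.l) = posPart a.l + s • posPart b.l := by
    rw [posPart_add, posPart_smul]
  refine Vec.ext ?_ ?_ (funext fun i => ?_) (funext fun i => ?_)
  · change lieField x.l x.c (a.l + s • b.l) + ∑ i, (dyad (x.f i) (a.f i + s • b.f i) -
      dyad (a.fs i + s • b.fs i) (x.fs i)) = (lieField x.l x.c a.l + ∑ i, (dyad (x.f i) (a.f i) -
      dyad (a.fs i) (x.fs i))) + s • (lieField x.l x.c b.l + ∑ i, (dyad (x.f i) (b.f i) -
      dyad (b.fs i) (x.fs i)))
    have e (i : Fin N) : dyad (x.f i) (a.f i + s • b.f i) - dyad (a.fs i + s • b.fs i) (x.fs i) =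
        (dyad (x.f i) (a.f i) - dyad (a.fs i) (x.fs i)) +
          s • (dyad (x.f i) (b.f i) - dyad (b.fs i) (x.fs i)) := by
      rw [dyad_add, add_dyad, dyad_smul, smul_dyad, smul_sub]
      abel
    rw [lieField_add_smul_right hx.1 x.c s ha.1 hb.1, Finset.sum_congr rfl fun i _ => e i,
      Finset.sum_add_distrib, ← Finset.smul_sum, smul_add]
    abel
  · change (0 : ℂ) = 0 + s * 0
    ring
  · change -(a.fs i + s • b.fs i) - act (posPart (a.l + s • b.l)) (x.f i) =
      (-a.fs i - act (posPart a.l) (x.f i)) + s • (-b.fs i - act (posPart b.l) (x.f i))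
    rw [hp, add_act pa pb, smul_act]
    module
  · change (a.f i + s • b.f i) + actT (posPart (a.l + s • b.l)) (x.fs i) =
      (a.f i + actT (posPart a.l) (x.fs i)) + s • (b.f i + actT (posPart b.l) (x.fs i))
    rw [hp, add_actT pa pb, smul_actT]
    module

/-- By `pair_theta` the function is affine in t, with the bracket pairing as its slope. -/
theorem hasDerivAt_pair_theta {x h a d : Vec N} (hx : x ∈ phaseExt N) (hh : h ∈ phaseExt N)
    (ha : a ∈ phase N) (hd : d ∈ phase N) :
    HasDerivAt (fun t : ℝ => pair a (theta (x + (t : ℂ) • h) d)) (pair (bracket d a) h) 0 := by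
  have e (t : ℝ) : pair a (theta (x + (t : ℂ) • h) d) =
      pair (bracket d a) x + (t : ℂ) * pair (bracket d a) h + canon d a := by
    rw [pair_theta (add_smul_mem_phaseExt t hx hh) hd ha,
      pair_add_smul _ (bracket_mem_phase hd ha) hx hh]
  simp only [e]
  have := (((hasDerivAt_id (0 : ℝ)).ofReal_comp.mul_const (pair (bracket d a) h)).const_add
    (pair (bracket d a) x)).add_const (canon d a)
  simpa using this

theorem isPoisson_theta : IsPoisson (theta : Vec N → Vec N → Vec N) where
  maps _ hx _ ha := theta_mem_phaseExt hx ha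
  linear _ hx _ ha _ hb s := theta_add_smul hx ha hb s
  skew x hx a ha b hb := by
    rw [pair_theta hx hb ha, pair_theta hx ha hb, pair_bracket_skew x hb ha, canon_skew b a]
    ring
  jacobi x hx a ha b hb d hd := by
    refine ⟨_, _, _, hasDerivAt_pair_theta hx (theta_mem_phaseExt hx hb) ha hd,
      hasDerivAt_pair_theta hx (theta_mem_phaseExt hx hd) hb ha,
      hasDerivAt_pair_theta hx (theta_mem_phaseExt hx ha) hd hb, ?_⟩
    -- Each derivative is a bracket paired with a value of Θ, so `pair_theta` applies a second time
    -- and yields double brackets.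
    rw [pair_theta hx hb (bracket_mem_phase hd ha), pair_theta hx hd (bracket_mem_phase ha hb),
      pair_theta hx ha (bracket_mem_phase hb hd)]
    exact bracket_jacobi hx ha hb hd

/-! ## The Bäcklund transformation -/

theorem bijOn_backlund : Set.BijOn (backlund : Vec N → Vec N) (phaseExt N) (phaseExt N) := by
  have hd {x : Vec N} (hx : IsL2 x) : ∑ i, dyad (x.f i) (x.fs i) ∈ dualOps :=
    sum_mem fun i _ => dyad_mem (hx i).1 (hx i).2
  refine ⟨fun x hx => ?_, fun x _ z _ e => ?_, fun x hx => ?_⟩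
  · rw [mem_phaseExt] at *
    exact ⟨add_mem hx.1 (hd hx.2), hx.2⟩
  · obtain ⟨l, c, f, fs⟩ := x
    obtain ⟨l', c', f', fs'⟩ := z
    simp only [backlund, Vec.mk.injEq] at e ⊢
    obtain ⟨hl, rfl, rfl, rfl⟩ := e
    exact ⟨add_right_cancel hl, rfl, rfl, rfl⟩
  · rw [mem_phaseExt] at hx
    refine ⟨⟨x.l - ∑ i, dyad (x.f i) (x.fs i), x.c, x.f, x.fs⟩,
      mem_phaseExt.2 ⟨sub_mem hx.1 (hd hx.2), hx.2⟩, ?_⟩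
    exact Vec.ext (sub_add_cancel _ _) rfl rfl rfl

theorem dyad_add_smul (t : ℂ) (f g h k : Coef) :
    dyad (f + t • h) (g + t • k) =
      dyad f g + t • (dyad h g + dyad f k) + (t ^ 2) • dyad h k := by
  rw [add_dyad, dyad_add, dyad_add, smul_dyad, smul_dyad, dyad_smul, dyad_smul]
  module

theorem hasDerivAt_pair_backlund {x h a : Vec N} (hx : x ∈ phaseExt N) (hh : h ∈ phaseExt N)
    (ha : a ∈ phase N) :
    HasDerivAt (fun t : ℝ => pair a (backlund (x + (t : ℂ) • h))) (pair a (backlundDeriv x h)) 0 := by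
  -- Dyads are bilinear, so the transformation is exactly quadratic along a line; `q` is the
  -- coefficient of t².
  set q : Op := ∑ i, dyad (h.f i) (h.fs i) with hq
  have lx := (mem_phaseExt.1 hx).2
  have lh := (mem_phaseExt.1 hh).2
  have mq' : q ∈ dualOps := sum_mem fun i _ => dyad_mem (lh i).1 (lh i).2
  have mq : (⟨q, 0, 0, 0⟩ : Vec N) ∈ phaseExt N :=
    mem_phaseExt.2 ⟨mq', fun _ => ⟨zero_mem _, zero_mem _⟩⟩
  have mB : backlund x ∈ phaseExt N := bijOn_backlund.mapsTo hx
  have mD : backlundDeriv x h ∈ phaseExt N := by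
    refine mem_phaseExt.2 ⟨add_mem (mem_phaseExt.1 hh).1 (sum_mem fun i _ => ?_), lh⟩
    exact add_mem (dyad_mem (lh i).1 (lx i).2) (dyad_mem (lx i).1 (lh i).2)
  have e (t : ℂ) : backlund (x + t • h) =
      backlund x + t • backlundDeriv x h + (t ^ 2) • (⟨q, 0, 0, 0⟩ : Vec N) := by
    refine Vec.ext ?_ ?_ (funext fun i => ?_) (funext fun i => ?_)
    · change x.l + t • h.l + ∑ i, dyad (x.f i + t • h.f i) (x.fs i + t • h.fs i) =
        x.l + ∑ i, dyad (x.f i) (x.fs i) +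
          t • (h.l + ∑ i, (dyad (h.f i) (x.fs i) + dyad (x.f i) (h.fs i))) + (t ^ 2) • q
      simp only [dyad_add_smul]
      rw [Finset.sum_add_distrib, Finset.sum_add_distrib, ← Finset.smul_sum, ← Finset.smul_sum,
        smul_add, hq]
      abel
    · change x.c + t * h.c = x.c + t * h.c + t ^ 2 * 0
      ring
    · change x.f i + t • h.f i = x.f i + t • h.f i + (t ^ 2) • 0
      rw [smul_zero, add_zero]
    · change x.fs i + t • h.fs i = x.fs i + t • h.fs i + (t ^ 2) • 0
      rw [smul_zero, add_zero]
  have e' (t : ℝ) : pair a (backlund (x + (t : ℂ) • h)) = pair a (backlund x) +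
      (t : ℂ) * pair a (backlundDeriv x h) + (t : ℂ) ^ 2 * pair a ⟨q, 0, 0, 0⟩ := by
    rw [e, pair_add_smul _ ha (add_smul_mem_phaseExt _ mB mD) mq, pair_add_smul _ ha mB mD]
  simp only [e']
  have h1 := (hasDerivAt_id (0 : ℝ)).ofReal_comp
  have := ((h1.mul_const (pair a (backlundDeriv x h))).const_add (pair a (backlund x))).add
    ((h1.pow 2).mul_const (pair a (⟨q, 0, 0, 0⟩ : Vec N)))
  exact this.congr_deriv (by simp)

theorem backlundAdj_mem_phase {x a : Vec N} (hx : x ∈ phaseExt N) (ha : a ∈ phase N) :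
    backlundAdj x a ∈ phase N := by
  rw [mem_phase] at *
  have pa := posPart_mem_posOps ha.1
  have lx := (mem_phaseExt.1 hx).2
  exact ⟨ha.1, fun i => ⟨add_mem (ha.2 i).1 (actT_mem pa (lx i).2),
    add_mem (ha.2 i).2 (act_mem pa (lx i).1)⟩⟩

theorem pair_backlundAdj {x a h : Vec N} (hx : x ∈ phaseExt N) (ha : a ∈ phase N)
    (hh : h ∈ phaseExt N) : pair (backlundAdj x a) h = pair a (backlundDeriv x h) := by
  rw [mem_phase] at ha
  rw [mem_phaseExt] at hx hh
  have pa := posPart_mem_posOps ha.1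
  have m1 (i : Fin N) := dyad_mem (hh.2 i).1 (hx.2 i).2
  have m2 (i : Fin N) := dyad_mem (hx.2 i).1 (hh.2 i).2
  have e (i : Fin N) : pairW (a.f i + actT (posPart a.l) (x.fs i)) (h.f i) +
      pairW (a.fs i + act (posPart a.l) (x.f i)) (h.fs i) =
      form a.l (dyad (h.f i) (x.fs i) + dyad (x.f i) (h.fs i)) +
        (pairW (a.f i) (h.f i) + pairW (a.fs i) (h.fs i)) := by
    obtain ⟨xf, xs⟩ := hx.2 i
    obtain ⟨hf, hs⟩ := hh.2 i
    rw [pairW_add_left (ha.2 i).1 (actT_mem pa xs) hf,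
      pairW_add_left (ha.2 i).2 (act_mem pa xf) hs, pairW_actT pa xs hf,
      form_add_right ha.1 (m1 i) (m2 i), form_dyad ha.1, form_dyad ha.1, pairW_comm (x.fs i)]
    ring
  change form a.l h.l + a.c * h.c + ∑ i, (pairW (a.f i + actT (posPart a.l) (x.fs i)) (h.f i) +
      pairW (a.fs i + act (posPart a.l) (x.f i)) (h.fs i)) =
    form a.l (h.l + ∑ i, (dyad (h.f i) (x.fs i) + dyad (x.f i) (h.fs i))) + a.c * h.c +
      ∑ i, (pairW (a.f i) (h.f i) + pairW (a.fs i) (h.fs i))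
  rw [Finset.sum_congr rfl fun i _ => e i, Finset.sum_add_distrib,
    form_add_right ha.1 hh.1 (sum_mem fun i _ => add_mem (m1 i) (m2 i)),
    form_sum_right _ ha.1 _ fun i => add_mem (m1 i) (m2 i)]
  ring

/-- By linearity the dyads added to l contribute through `lieField_dyad` exactly the terms that
arise from inserting the action terms of `backlundAdj` into the derivative. -/
theorem theta_backlund {x a : Vec N} (hx : x ∈ phaseExt N) (ha : a ∈ phase N) :
    theta (backlund x) a = backlundDeriv x (thetaTilde x (backlundAdj x a)) := by
  rw [mem_phase] at ha
  rw [mem_phaseExt] at hx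
  refine Vec.ext ?_ rfl (funext fun i => ?_) rfl
  · change lieField (x.l + ∑ i, dyad (x.f i) (x.fs i)) x.c a.l +
      ∑ i, (dyad (x.f i) (a.f i) - dyad (a.fs i) (x.fs i)) =
      lieField x.l x.c a.l + ∑ i, (dyad (-(a.fs i + act (posPart a.l) (x.f i))) (x.fs i) +
        dyad (x.f i) (a.f i + actT (posPart a.l) (x.fs i)))
    have m (i : Fin N) := dyad_mem (hx.2 i).1 (hx.2 i).2
    have h := lieField_add_left hx.1 (sum_mem fun i (_ : i ∈ Finset.univ) => m i) x.c 0 ha.1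
    rw [add_zero] at h
    rw [h, lieField_sum _ _ m ha.1, add_assoc, ← Finset.sum_add_distrib]
    refine congrArg (lieField x.l x.c a.l + ·) (Finset.sum_congr rfl fun i _ => ?_)
    rw [lieField_dyad (hx.2 i).1 (hx.2 i).2 ha.1, neg_dyad, add_dyad, dyad_add]
    abel
  · change -a.fs i - act (posPart a.l) (x.f i) = -(a.fs i + act (posPart a.l) (x.f i))
    abel

/-! ## Casimir functionals -/

/-- A covector is determined by its pairings with the tangent vectors of the phase space. -/
theorem eq_of_pair_eq {a a' : Vec N} (ha : a ∈ phase N) (ha' : a' ∈ phase N)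
    (h : ∀ v ∈ phase N, pair a v = pair a' v) : a = a' := by
  rw [mem_phase] at ha ha'
  have h0 : IsL2 (⟨0, 0, 0, 0⟩ : Vec N) := fun i => ⟨zero_mem _, zero_mem _⟩
  have hsingle {t : Coef} (ht : t ∈ Lp ℂ 2 mu) (i j : Fin N) :
      (Pi.single i t : Fin N → Coef) j ∈ Lp ℂ 2 mu := by
    rcases eq_or_ne j i with rfl | hj
    · simpa using ht
    · rw [Pi.single_eq_of_ne hj]
      exact zero_mem _
  have psingle (f : Fin N → Coef) (i : Fin N) (t : Coef) :
      ∑ j, pairW (f j) ((Pi.single i t : Fin N → Coef) j) = pairW (f i) t := by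
    rw [Finset.sum_eq_single i (fun j _ hj => by rw [Pi.single_eq_of_ne hj, pairW_zero_right])
      (fun hi => absurd (Finset.mem_univ i) hi), Pi.single_eq_same]
  refine Vec.ext ?_ ?_ (funext fun i => ?_) (funext fun i => ?_)
  · refine sub_eq_zero.1 (eq_zero_of_form (sub_mem ha.1 ha'.1) fun B hB => ?_)
    have := h ⟨B, 0, 0, 0⟩ (mem_phase.2 ⟨hB, h0⟩)
    simp only [pair, Pi.zero_apply, pairW_zero_right, mul_zero, add_zero,
      Finset.sum_const_zero] at this
    rw [form_sub_left ha.1 ha'.1 (loopOps_le_dualOps hB), this, sub_self]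
  · have := h ⟨0, 1, 0, 0⟩ (mem_phase.2 ⟨zero_mem _, h0⟩)
    simpa only [pair, Pi.zero_apply, pairW_zero_right, form_zero_right, mul_one, add_zero,
      zero_add, Finset.sum_const_zero] using this
  · refine sub_eq_zero.1 (eq_zero_of_pairW (sub_mem (ha.2 i).1 (ha'.2 i).1) fun t ht => ?_)
    have := h ⟨0, 0, Pi.single i t, 0⟩
      (mem_phase.2 ⟨zero_mem _, fun j => ⟨hsingle ht i j, zero_mem _⟩⟩)
    simp only [pair, Pi.zero_apply, pairW_zero_right, form_zero_right, mul_zero, add_zero,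
      zero_add, psingle] at this
    rw [pairW_sub_left (ha.2 i).1 (ha'.2 i).1 ht, this, sub_self]
  · refine sub_eq_zero.1 (eq_zero_of_pairW (sub_mem (ha.2 i).2 (ha'.2 i).2) fun t ht => ?_)
    have := h ⟨0, 0, 0, Pi.single i t⟩
      (mem_phase.2 ⟨zero_mem _, fun j => ⟨zero_mem _, hsingle ht i j⟩⟩)
    simp only [pair, Pi.zero_apply, pairW_zero_right, form_zero_right, mul_zero, add_zero,
      zero_add, psingle] at this
    rw [pairW_sub_left (ha.2 i).2 (ha'.2 i).2 ht, this, sub_self]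

theorem HasGradientAt.unique {F : Vec N → ℂ} {x a a' : Vec N} (ha : HasGradientAt F x a)
    (ha' : HasGradientAt F x a') : a = a' :=
  eq_of_pair_eq ha.1 ha'.1 fun v hv => (ha.2 v hv).unique (ha'.2 v hv)

/-- The coadjoint invariance of a functional with gradient `r` means `[l - c∂/∂y, r] = 0`. -/
theorem laxComm_eq_zero {l r : Op} {c : ℂ} (hl : l ∈ loopOps) (hr : r ∈ loopOps)
    (h : ∀ A ∈ loopOps, form l (opComm A r) + c * omega A r = 0) : laxComm l c r = 0 := by
  have dl := loopOps_le_dualOps hl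
  have hm : laxComm l c r ∈ loopOps :=
    sub_mem (opComm_mem_loopOps hl hr) (Submodule.smul_mem _ c (dyOp_mem_loopOps hr))
  refine eq_zero_of_form hm fun B hB => ?_
  have e := h B hB
  rw [← form_comm (opComm_mem_loopOps hB hr) dl] at e
  rw [← form_comm hB (loopOps_le_dualOps hm), form_laxComm c hB hr dl, opComm_anticomm,
    form_neg_left]
  linear_combination -e

theorem laxField_mem_phase {r : Op} (hr : r ∈ loopOps) {x : Vec N} (hx : x ∈ phase N) :
    laxField r x ∈ phase N := by
  rw [mem_phase] at *
  have pr := posPart_mem_posOps hr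
  exact ⟨add_mem (opComm_mem_loopOps pr.1 hx.1) (Submodule.smul_mem _ _ (dyOp_mem_loopOps pr.1)),
    fun i => ⟨act_mem pr (hx.2 i).1, neg_mem (actT_mem pr (hx.2 i).2)⟩⟩

/-- When r commutes with l - c∂ the truncated term drops out, and the dyads vanish because the
covector has no f or f^* component. The central component κ is arbitrary because Θ does not depend
on it. -/
theorem laxField_eq_neg_theta {x : Vec N} {r : Op} {κ : ℂ} (h : laxComm x.l x.c r = 0) :
    laxField r x = -theta x ⟨r, κ, 0, 0⟩ := by
  have hd (f : Coef) : dyad f 0 = 0 := by simpa using dyad_smul 0 f 0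
  have hd' (f : Coef) : dyad 0 f = 0 := by simpa using smul_dyad 0 0 f
  have hs : strictPart (0 : Op) = 0 := by simpa using strictPart_smul 0 0
  refine Vec.ext ?_ ?_ (funext fun i => ?_) (funext fun i => ?_)
  · change opComm (posPart r) x.l + x.c • dyOp (posPart r) =
      -(laxComm x.l x.c (posPart r) - strictPart (laxComm x.l x.c r) +
        ∑ i, (dyad (x.f i) 0 - dyad 0 (x.fs i)))
    simp only [h, hs, hd, hd', sub_zero, Finset.sum_const_zero, add_zero]
    rw [laxComm, opComm_anticomm]
    abel
  · change (0 : ℂ) = -0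
    rw [neg_zero]
  · change act (posPart r) (x.f i) = -(-0 - act (posPart r) (x.f i))
    abel
  · change -actT (posPart r) (x.fs i) = -(0 + actT (posPart r) (x.fs i))
    rw [zero_add]

/-- Extending γ independently of (f, f^*) extends its gradient by zero; uniqueness then lets the
identity for this gradient cover any other. -/
theorem isHamiltonianAt_laxField {U : Set (Op × ℂ)} {γ : Op × ℂ → ℂ} {grad : Op × ℂ → Op × ℂ}
    (hγ : IsCasimirOn U γ grad) {x : Vec N} (hx : x ∈ phase N) (hU : (x.l, x.c) ∈ U) :
    IsHamiltonianAt theta (fun z => γ (z.l, z.c)) x (laxField (grad (x.l, x.c)).1 x) := by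
  obtain ⟨hr, hder, hinv⟩ := hγ _ hU
  set r := (grad (x.l, x.c)).1
  have hr' := mem_loopOps.2 hr
  have hgrad : HasGradientAt (fun z : Vec N => γ (z.l, z.c)) x
      ⟨r, (grad (x.l, x.c)).2, 0, 0⟩ := by
    refine ⟨mem_phase.2 ⟨hr', fun i => ⟨zero_mem _, zero_mem _⟩⟩, fun h hh => ?_⟩
    have := hder h.l hh.1 h.c
    simp only [pair, Pi.zero_apply, pairW_zero_left, add_zero, Finset.sum_const_zero]
    exact this
  refine ⟨⟨_, hgrad, fun a ha => ha.unique hgrad⟩, fun a ha => ?_⟩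
  rw [ha.unique hgrad]
  exact laxField_eq_neg_theta (laxComm_eq_zero (mem_phase.1 hx).1 hr' fun A hA =>
    hinv A (mem_loopOps.1 hA))

end ShiftLoop

theorem theorem6 (N : ℕ) :
    -- the untransformed structure: the Lie-Poisson bracket of the `ℛ`-deformed central extension
    -- together with the canonical bracket of the eigenfunctions
    (∀ x ∈ phaseExt N, ∀ a ∈ phase N, ∀ b ∈ phase N,
      pair b (thetaTilde x a) =
        form x.l (rComm a.l b.l) + x.c * rOmega a.l b.l
          + ∑ i, (pairW (b.fs i) (a.f i) - pairW (b.f i) (a.fs i))) ∧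
    -- the Bäcklund transformation, its derivative and the conjugate of its derivative
    Set.BijOn backlund (phaseExt N) (phaseExt N) ∧
    (∀ x ∈ phaseExt N, ∀ h ∈ phaseExt N, ∀ a ∈ phase N,
      HasDerivAt (fun t : ℝ => pair a (backlund (x + (t : ℂ) • h)))
        (pair a (backlundDeriv x h)) 0) ∧
    (∀ x ∈ phaseExt N, ∀ a ∈ phase N, backlundAdj x a ∈ phase N ∧
      ∀ h ∈ phaseExt N, pair (backlundAdj x a) h = pair a (backlundDeriv x h)) ∧
    -- `Θ = B' Θ̃ B'^*`
    (∀ x ∈ phaseExt N, ∀ a ∈ phase N,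
      theta (backlund x) a = backlundDeriv x (thetaTilde x (backlundAdj x a))) ∧
    -- `Θ` is a Poisson structure
    IsPoisson (theta : Vec N → Vec N → Vec N) ∧
    -- the coupled hierarchy is Hamiltonian, with the Casimir functionals as Hamiltonians
    (∀ (U : Set (Op × ℂ)) (γ : ℕ → Op × ℂ → ℂ) (grad : ℕ → Op × ℂ → Op × ℂ),
      (∀ n, IsCasimirOn U (γ n) (grad n)) →
      ∀ n, ∀ x ∈ phase N, (x.l, x.c) ∈ U →
        laxField (grad n (x.l, x.c)).1 x ∈ phase N ∧
        IsHamiltonianAt theta (fun z => γ n (z.l, z.c)) x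
          (laxField (grad n (x.l, x.c)).1 x)) := by
  refine ⟨fun x hx a ha b hb => pair_thetaTilde hx ha hb, bijOn_backlund,
    fun x hx h hh a ha => hasDerivAt_pair_backlund hx hh ha,
    fun x hx a ha => ⟨backlundAdj_mem_phase hx ha, fun h hh => pair_backlundAdj hx ha hh⟩,
    fun x hx a ha => theta_backlund hx ha, isPoisson_theta, ?_⟩
  intro U γ grad hγ n x hx hU
  exact ⟨laxField_mem_phase (mem_loopOps.2 (hγ n _ hU).1) hx,
    isHamiltonianAt_laxField (hγ n) hx hU⟩
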